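/- Throughout, \(\mathbb N=\{1,2,3,\dots\}\), functions are complex-valued and \(\mathbb T=\{\lambda\in\mathbb C:|\lambda|=1\}\). Let \((X,\mu)\) be a probability space (in particular, any Borel probability space). A *Dunford–Schwartz operator* is a linear operator \(T\) on \(L^1(X,\mu)\) with \(\|Tf\|_1\le\|f\|_1\) for all \(f\in L^1\) and \(\|Tf\|_\infty\le\|f\|_\infty\) for all \(f\in L^\infty\); such an operator restricts to a contraction of \(L^p(X,\mu)\) for every \(1\le p<\infty\), again denoted \(T\). Let \(m>1\) and \(k\) be positive integers, \(\alpha:\{1,\dots,m\}\to\{1,\dots,k\}\) a not necessarily surjective map, and \(T_1,\dots,T_m\) Dunford–Schwartz operators on \((X,\mu)\). Let \(p\in[1,\infty)\), \(E:=L^p(X,\mu)\), and let \(A_1,\dots,A_{m-1}\) be bounded linear operators on \(E\). Let \(E=E_{1;r}\oplus E_{1;s}\) be the Jacobs–Glicksberg–deLeeuw decomposition for \(T_1\) on \(E\), where \[ E_{1;r}=\overline{\operatorname{lin}}\{f\in E:\ T_1f=\lambda f\text{ for some }\lambda\in\mathbb T\}, \] \[ E_{1;s}=\Big\{f\in E:\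 (\varphi(T_1^nf))_{n}\text{ is bounded and }\lim_{N\to\infty}\frac1N\sum_{n=1}^N|\varphi(T_1^nf)|=0\text{ for every }\varphi\in E'\Big\}. \] Suppose that the following conditions hold. (A1) (Twisted compactness) For every \(f\in E\), \(1\le j\le m-1\) and \(\varepsilon>0\) there is a decomposition \(E=\mathcal U\oplus\mathcal R\) into closed subspaces with \(0<\dim\mathcal U<\infty\) such that, \(P_{\mathcal R}\) denoting the projection along \(\mathcal U\) onto \(\mathcal R\), \[ \|P_{\mathcal R}A_jT_j^nf\|_{\infty}<\varepsilon\qquad\text{for all }n\in\mathbb N. \] (A2) (Joint \(L^\infty\)-boundedness) There is a constant \(C>0\) such that \(\|A_jT_j^nf\|_\infty\le C\|f\|_\infty\) for all \(f\in L^\infty(X,\mu)\), \(n\in\mathbb N\) and \(1\le j\le m-1\). Then: 1. for each \(f\in E_{1;s}\), \[ \frac1{N^k}\sum_{1\le n_1,\dots,n_k\le N}\left|T_m^{n_{\alpha(m)}}A_{m-1}T_{m-1}^{n_{\alpha(m-1)}}\cdots A_2T_2^{n_{\alpha(2)}}A_1T_1^{n_{\alpha(1)}}f\right|\longrightarrow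 0\quad(N\to\infty) \] pointwise \(\mu\)-a.e.; 2. for each \(f\in E_{1;r}\), the averages \[ \frac1{N^k}\sum_{1\le n_1,\dots,n_k\le N}T_m^{n_{\alpha(m)}}A_{m-1}T_{m-1}^{n_{\alpha(m-1)}}\cdots A_2T_2^{n_{\alpha(2)}}A_1T_1^{n_{\alpha(1)}}f \] converge pointwise \(\mu\)-a.e. (to a finite limit) as \(N\to\infty\). -/

import Mathlib

open MeasureTheory Filter Topology
open scoped ENNReal

namespace EntangledErgodic

variable {X : Type*} [MeasurableSpace X] {μ : Measure X}

/-- A Dunford–Schwartz operator: a linear contraction of (complex) `L¹(μ)` which is also a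
contraction for the `L^∞`-norm. (For `f ∉ L^∞` the second inequality reads `_ ≤ ∞`.) -/
structure IsDunfordSchwartz (T : Lp ℂ 1 μ →L[ℂ] Lp ℂ 1 μ) : Prop where
  norm_le_one : ‖T‖ ≤ 1
  eLpNorm_top_le : ∀ f : Lp ℂ 1 μ, eLpNorm (T f) ∞ μ ≤ eLpNorm f ∞ μ

/-- `s ^ q` as a superposition of the functions `(s - t)₊`, `t > 0`. -/
theorem lintegral_hinge {q : ℝ} (hq : 1 < q) {s : ℝ} (hs : 0 ≤ s) :
    ∫⁻ t in Set.Ioi (0 : ℝ), ENNReal.ofReal (q * (q - 1) * t ^ (q - 2)) * ENNReal.ofReal (s - t)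
      = ENNReal.ofReal (s ^ q) := by
  have h1 : ∫⁻ t in Set.Ioi (0 : ℝ),
        ENNReal.ofReal (q * (q - 1) * t ^ (q - 2)) * ENNReal.ofReal (s - t)
      = ∫⁻ t in Set.Ioc (0 : ℝ) s,
        ENNReal.ofReal (q * (q - 1) * t ^ (q - 2) * (s - t)) := by
    rw [← lintegral_indicator measurableSet_Ioi, ← lintegral_indicator measurableSet_Ioc]
    refine lintegral_congr fun t => ?_
    by_cases h0 : 0 < t
    · by_cases h2 : t ≤ s
      · rw [Set.indicator_of_mem (show t ∈ Set.Ioi 0 from h0),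
          Set.indicator_of_mem (show t ∈ Set.Ioc 0 s from ⟨h0, h2⟩)]
        have h3 : 0 < q - 1 := by linarith
        have h4 : 0 ≤ t ^ (q - 2) := Real.rpow_nonneg h0.le _
        have h5 : 0 ≤ q := by linarith
        rw [← ENNReal.ofReal_mul (mul_nonneg (mul_nonneg h5 h3.le) h4)]
      · rw [Set.indicator_of_mem (show t ∈ Set.Ioi 0 from h0),
          Set.indicator_of_notMem (fun h => h2 h.2),
          ENNReal.ofReal_of_nonpos (by linarith : s - t ≤ 0), mul_zero]
    · rw [Set.indicator_of_notMem (show t ∉ Set.Ioi 0 from h0),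
        Set.indicator_of_notMem (fun h => h0 h.1)]
  have hi1 : IntervalIntegrable (fun t : ℝ => t ^ (q - 2)) volume 0 s :=
    intervalIntegral.intervalIntegrable_rpow' (by linarith)
  have hi2 : IntervalIntegrable (fun t : ℝ => t ^ (q - 1)) volume 0 s :=
    intervalIntegral.intervalIntegrable_rpow' (by linarith)
  have heq : ∀ t ∈ Set.Ioc (0 : ℝ) s, q * (q - 1) * t ^ (q - 2) * (s - t)
      = q * (q - 1) * s * t ^ (q - 2) - q * (q - 1) * t ^ (q - 1) := by
    intro t ht
    have : t ^ (q - 1) = t ^ (q - 2) * t := by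
      rw [← Real.rpow_add_one ht.1.ne']; congr 1; ring
    rw [this]; ring
  have hi3 : IntervalIntegrable
      (fun t : ℝ => q * (q - 1) * s * t ^ (q - 2) - q * (q - 1) * t ^ (q - 1)) volume 0 s :=
    (hi1.const_mul _).sub (hi2.const_mul _)
  have hi4 : IntegrableOn (fun t : ℝ => q * (q - 1) * t ^ (q - 2) * (s - t))
      (Set.Ioc 0 s) volume :=
    (((intervalIntegrable_iff_integrableOn_Ioc_of_le hs).1 hi3).congr_fun
      (fun t ht => (heq t ht).symm) measurableSet_Ioc)
  rw [h1, ← ofReal_integral_eq_lintegral_ofReal hi4, setIntegral_congr_fun measurableSet_Ioc heq,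
    ← intervalIntegral.integral_of_le hs, intervalIntegral.integral_sub (hi1.const_mul _)
    (hi2.const_mul _), intervalIntegral.integral_const_mul, intervalIntegral.integral_const_mul,
    integral_rpow (Or.inl (by linarith)), integral_rpow (Or.inl (by linarith))]
  · congr 1
    have e1 : q - 2 + 1 = q - 1 := by ring
    have e2 : q - 1 + 1 = q := by ring
    have hq1 : q - 1 ≠ 0 := by linarith
    have hq0 : q ≠ 0 := by linarith
    rw [e1, e2, Real.zero_rpow hq1, Real.zero_rpow hq0]
    rcases hs.eq_or_lt with rfl | hs'
    · rw [Real.zero_rpow hq1, Real.zero_rpow hq0]; simp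
    · have : s ^ q = s * s ^ (q - 1) := by
        rw [mul_comm, ← Real.rpow_add_one hs'.ne']; congr 1; ring
      rw [this]; field_simp; ring
  · refine (ae_restrict_iff' measurableSet_Ioc).2 (Eventually.of_forall fun t ht => ?_)
    have h5 : 0 < q - 1 := by linarith
    have h6 : 0 ≤ s - t := by linarith [ht.2]
    have h7 : 0 < t := ht.1
    simp only [Pi.zero_apply]
    positivity

theorem IsDunfordSchwartz.lintegral_hinge_le [IsProbabilityMeasure μ]
    {T : Lp ℂ 1 μ →L[ℂ] Lp ℂ 1 μ} (hT : IsDunfordSchwartz T) (f : Lp ℂ 1 μ) {t : ℝ} (ht : 0 < t) :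
    ∫⁻ x, ENNReal.ofReal (‖T f x‖ - t) ∂μ ≤ ∫⁻ x, ENNReal.ofReal (‖f x‖ - t) ∂μ := by
  set g : X → ℂ := fun x => (t / max t ‖f x‖ : ℝ) • f x with hg
  have hfm : AEStronglyMeasurable f μ := Lp.aestronglyMeasurable f
  have hgm : AEStronglyMeasurable g μ := by
    have h1 : AEMeasurable (fun x => t / max t ‖f x‖) μ :=
      aemeasurable_const.div (aemeasurable_const.max hfm.norm.aemeasurable)
    exact h1.aestronglyMeasurable.smul hfm
  have hgt : ∀ x, ‖g x‖ ≤ t := by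
    intro x
    have hm : 0 < max t ‖f x‖ := lt_max_of_lt_left ht
    rw [hg]; simp only
    rw [norm_smul, Real.norm_of_nonneg (by positivity), div_mul_eq_mul_div, div_le_iff₀ hm]
    gcongr; exact le_max_right _ _
  have hgp : MemLp g 1 μ := MemLp.of_bound hgm t (Eventually.of_forall hgt)
  set gL : Lp ℂ 1 μ := hgp.toLp g with hgL
  have hsub : ∀ x, ‖f x - g x‖ₑ = ENNReal.ofReal (‖f x‖ - t) := by
    intro x
    have hm : 0 < max t ‖f x‖ := lt_max_of_lt_left ht
    have : f x - g x = (1 - t / max t ‖f x‖ : ℝ) • f x := by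
      rw [sub_smul, one_smul]
    rw [this, ← ofReal_norm, norm_smul, Real.norm_of_nonneg]
    · rcases le_total ‖f x‖ t with h | h
      · rw [max_eq_left h, div_self ht.ne', sub_self, zero_mul, ENNReal.ofReal_zero,
          ENNReal.ofReal_of_nonpos (by linarith)]
      · rw [max_eq_right h]
        have : ‖f x‖ ≠ 0 := by linarith
        congr 1; field_simp
    · rw [sub_nonneg, div_le_one hm]; exact le_max_left _ _
  have hTg : ∀ᵐ x ∂μ, ‖T gL x‖ ≤ t := by
    have h1 : eLpNorm (T gL) ∞ μ ≤ ENNReal.ofReal t := by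
      refine (hT.eLpNorm_top_le gL).trans ?_
      rw [eLpNorm_congr_ae hgp.coeFn_toLp, eLpNorm_exponent_top]
      exact eLpNormEssSup_le_of_ae_bound (Eventually.of_forall hgt)
    rw [eLpNorm_exponent_top] at h1
    filter_upwards [enorm_ae_le_eLpNormEssSup (T gL) μ] with x hx
    have := hx.trans h1
    rwa [← ofReal_norm, ENNReal.ofReal_le_ofReal_iff ht.le] at this
  have hadd : T f = T gL + T (f - gL) := by rw [← map_add, add_sub_cancel]
  calc ∫⁻ x, ENNReal.ofReal (‖T f x‖ - t) ∂μ
      ≤ ∫⁻ x, ‖T (f - gL) x‖ₑ ∂μ := by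
        refine lintegral_mono_ae ?_
        have h2 := Lp.coeFn_add (T gL) (T (f - gL))
        rw [← hadd] at h2
        filter_upwards [h2, hTg] with x hx hx2
        rw [← ofReal_norm]
        apply ENNReal.ofReal_le_ofReal
        rw [hx, Pi.add_apply]
        linarith [norm_add_le (T gL x) (T (f - gL) x)]
    _ = ‖T (f - gL)‖ₑ := by rw [Lp.enorm_def, eLpNorm_one_eq_lintegral_enorm]
    _ ≤ ‖f - gL‖ₑ := by
        rw [← ofReal_norm, ← ofReal_norm]
        apply ENNReal.ofReal_le_ofReal
        simpa using T.le_of_opNorm_le hT.norm_le_one (f - gL)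
    _ = ∫⁻ x, ‖(f - gL : Lp ℂ 1 μ) x‖ₑ ∂μ := by rw [Lp.enorm_def, eLpNorm_one_eq_lintegral_enorm]
    _ = ∫⁻ x, ENNReal.ofReal (‖f x‖ - t) ∂μ := by
        refine lintegral_congr_ae ?_
        filter_upwards [Lp.coeFn_sub f gL, hgp.coeFn_toLp] with x h1 h2
        rw [h1, Pi.sub_apply, hgL, h2, hsub]

/-- A Dunford–Schwartz operator is a contraction for every `L^p`-norm. -/
theorem IsDunfordSchwartz.eLpNorm_le [IsProbabilityMeasure μ]
    {T : Lp ℂ 1 μ →L[ℂ] Lp ℂ 1 μ} (hT : IsDunfordSchwartz T) {p : ℝ≥0∞} (hp : 1 ≤ p)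
    (f : Lp ℂ 1 μ) : eLpNorm (T f) p μ ≤ eLpNorm f p μ := by
  rcases eq_or_ne p ∞ with rfl | hpt
  · exact hT.eLpNorm_top_le f
  rcases hp.eq_or_lt with rfl | hp1
  · rw [← Lp.enorm_def, ← Lp.enorm_def, ← ofReal_norm, ← ofReal_norm]
    apply ENNReal.ofReal_le_ofReal
    simpa using T.le_of_opNorm_le hT.norm_le_one f
  have hq : 1 < p.toReal := by
    rw [← ENNReal.toReal_one]; exact (ENNReal.toReal_lt_toReal (by simp) hpt).2 hp1
  have key : ∀ h : Lp ℂ 1 μ, ∫⁻ x, ‖h x‖ₑ ^ p.toReal ∂μ = ∫⁻ t in Set.Ioi (0 : ℝ),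
      ENNReal.ofReal (p.toReal * (p.toReal - 1) * t ^ (p.toReal - 2)) *
        ∫⁻ x, ENNReal.ofReal (‖h x‖ - t) ∂μ := by
    intro h
    have hm : AEMeasurable (fun x => ‖h x‖) μ := (Lp.aestronglyMeasurable h).norm.aemeasurable
    calc ∫⁻ x, ‖h x‖ₑ ^ p.toReal ∂μ
        = ∫⁻ x, ∫⁻ t in Set.Ioi (0 : ℝ),
            ENNReal.ofReal (p.toReal * (p.toReal - 1) * t ^ (p.toReal - 2)) *
              ENNReal.ofReal (‖h x‖ - t) ∂volume ∂μ := by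
          refine lintegral_congr fun x => ?_
          rw [lintegral_hinge hq (norm_nonneg _), ← ofReal_norm,
            ENNReal.ofReal_rpow_of_nonneg (norm_nonneg _) (by linarith)]
      _ = _ := by
          rw [lintegral_lintegral_swap]
          · refine lintegral_congr fun t => ?_
            rw [lintegral_const_mul' _ _ ENNReal.ofReal_ne_top]
          · have h1 : Measurable fun z : X × ℝ =>
                ENNReal.ofReal (p.toReal * (p.toReal - 1) * z.2 ^ (p.toReal - 2)) := by fun_prop
            have h2 : AEMeasurable (fun z : X × ℝ => ENNReal.ofReal (‖h z.1‖ - z.2))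
                (μ.prod (volume.restrict (Set.Ioi (0 : ℝ)))) :=
              (hm.comp_fst.sub measurable_snd.aemeasurable).ennreal_ofReal
            exact h1.aemeasurable.mul h2
  rw [eLpNorm_eq_lintegral_rpow_enorm_toReal (by positivity) hpt,
    eLpNorm_eq_lintegral_rpow_enorm_toReal (by positivity) hpt, key, key]
  refine ENNReal.rpow_le_rpow (setLIntegral_mono' measurableSet_Ioi fun t ht => ?_) (by positivity)
  exact mul_le_mul_right (hT.lintegral_hinge_le f ht) _

/-- The inclusion `L^p(μ) ⊆ L¹(μ)`. -/
def toL1 [IsProbabilityMeasure μ] {p : ℝ≥0∞} [hp : Fact (1 ≤ p)] (f : Lp ℂ p μ) : Lp ℂ 1 μ :=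
  ⟨f.1, Lp.antitone hp.out f.2⟩

/-- The operator on `L^p(μ)` obtained by restricting a Dunford–Schwartz operator to `L^p(μ)`. -/
noncomputable def IsDunfordSchwartz.onLp [IsProbabilityMeasure μ]
    {T : Lp ℂ 1 μ →L[ℂ] Lp ℂ 1 μ} (hT : IsDunfordSchwartz T) (p : ℝ≥0∞) [hp : Fact (1 ≤ p)] :
    Lp ℂ p μ →L[ℂ] Lp ℂ p μ :=
  LinearMap.mkContinuous
    { toFun := fun f => ⟨(T (toL1 f)).1, Lp.mem_Lp_iff_eLpNorm_lt_top.2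
        ((hT.eLpNorm_le hp.out (toL1 f)).trans_lt (Lp.eLpNorm_lt_top f))⟩
      map_add' := fun f g => by
        have h : T (toL1 (f + g)) = T (toL1 f) + T (toL1 g) := map_add T (toL1 f) (toL1 g)
        exact Subtype.ext (congrArg (fun u : Lp ℂ 1 μ => u.1) h)
      map_smul' := fun c f => by
        have h : T (toL1 (c • f)) = c • T (toL1 f) := map_smul T c (toL1 f)
        exact Subtype.ext (congrArg (fun u : Lp ℂ 1 μ => u.1) h) }
    1 (fun f => by
      rw [one_mul, Lp.norm_def, Lp.norm_def]
      exact ENNReal.toReal_mono (Lp.eLpNorm_ne_top f) (hT.eLpNorm_le hp.out (toL1 f)))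

/-- The class of bounded sequences `(a n)`, `n ≥ 1`, with `(1/N) ∑_{n ≤ N} |a n| → 0`. -/
def IsCesaroNull (a : ℕ → ℂ) : Prop :=
  (∃ C : ℝ, ∀ n, 1 ≤ n → ‖a n‖ ≤ C) ∧
    Tendsto (fun N : ℕ => (1 / (N : ℝ)) * ∑ n ∈ Finset.Icc 1 N, ‖a n‖) atTop (𝓝 0)

/-- The reversible part of the Jacobs–Glicksberg–deLeeuw decomposition: the closed linear span of
the eigenvectors of `S` with unimodular eigenvalue. -/
def reversiblePart {E : Type*} [NormedAddCommGroup E] [NormedSpace ℂ E] (S : E →L[ℂ] E) :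
    Submodule ℂ E :=
  (Submodule.span ℂ {f : E | ∃ c : ℂ, ‖c‖ = 1 ∧ S f = c • f}).topologicalClosure

/-- The stable part of the Jacobs–Glicksberg–deLeeuw decomposition. -/
def stablePart {E : Type*} [NormedAddCommGroup E] [NormedSpace ℂ E] (S : E →L[ℂ] E) : Set E :=
  {f : E | ∀ φ : E →L[ℂ] ℂ, IsCesaroNull fun n => φ ((S ^ n) f)}

section Conditions

variable {p : ℝ≥0∞} [Fact (1 ≤ p)] {m : ℕ}

/-- Twisted compactness. The space `E = L^p` is the direct sum of the closed subspaces `U`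
and `R`, and `R.projection U hRU` is the projection onto `R` along `U`.
The index `j : Fin (m - 1)` is zero-based. -/
def TwistedCompactness (S : Fin m → Lp ℂ p μ →L[ℂ] Lp ℂ p μ)
    (A : Fin (m - 1) → Lp ℂ p μ →L[ℂ] Lp ℂ p μ) : Prop :=
  ∀ (f : Lp ℂ p μ) (j : Fin (m - 1)) (ε : ℝ), 0 < ε →
    ∃ (U R : Submodule ℂ (Lp ℂ p μ)) (hRU : IsCompl R U),
      IsClosed (R : Set (Lp ℂ p μ)) ∧ FiniteDimensional ℂ U ∧ 0 < Module.finrank ℂ U ∧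
      ∀ n : ℕ, 1 ≤ n →
        eLpNorm (R.projection U hRU (A j ((S (j.castLE (Nat.sub_le m 1)) ^ n) f)) : Lp ℂ p μ) ∞ μ
          < ENNReal.ofReal ε

/-- Joint `L^∞`-boundedness: all `A_j T_j^n` act on `L^∞ ⊆ L^p` as operators of norm `≤ C`.
(For `f ∉ L^∞` the inequality reads `_ ≤ ∞`.) -/
def JointLinftyBounded (S : Fin m → Lp ℂ p μ →L[ℂ] Lp ℂ p μ)
    (A : Fin (m - 1) → Lp ℂ p μ →L[ℂ] Lp ℂ p μ) : Prop :=
  ∃ C : ℝ, 0 < C ∧ ∀ (j : Fin (m - 1)) (n : ℕ), 1 ≤ n → ∀ f : Lp ℂ p μ,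
    eLpNorm (A j ((S (j.castLE (Nat.sub_le m 1)) ^ n) f)) ∞ μ
      ≤ ENNReal.ofReal C * eLpNorm f ∞ μ

end Conditions

/-- The partial products, with zero-based indices:
`S_j ^ (n (α j)) A_{j-1} S_{j-1} ^ (n (α (j-1))) ⋯ A_0 S_0 ^ (n (α 0)) f`. -/
def entangledStage {E : Type*} [NormedAddCommGroup E] [NormedSpace ℂ E] {m k : ℕ}
    (S : Fin m → E →L[ℂ] E) (A : Fin (m - 1) → E →L[ℂ] E) (α : Fin m → Fin k)
    (n : Fin k → ℕ) (f : E) : (j : ℕ) → j < m → E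
  | 0, h => (S ⟨0, h⟩ ^ n (α ⟨0, h⟩)) f
  | j + 1, h => (S ⟨j + 1, h⟩ ^ n (α ⟨j + 1, h⟩))
      (A ⟨j, Nat.lt_sub_of_add_lt h⟩
        (entangledStage S A α n f j (Nat.lt_of_succ_lt h)))

/-- The full entangled product applied to `f`, i.e. (with one-based indices)
`T_m ^ n_{α(m)} A_{m-1} T_{m-1} ^ n_{α(m-1)} ⋯ A_1 T_1 ^ n_{α(1)} f`. -/
def entangledProduct {E : Type*} [NormedAddCommGroup E] [NormedSpace ℂ E] {m k : ℕ} (hm : 1 < m)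
    (S : Fin m → E →L[ℂ] E) (A : Fin (m - 1) → E →L[ℂ] E) (α : Fin m → Fin k)
    (n : Fin k → ℕ) (f : E) : E :=
  entangledStage S A α n f (m - 1) (Nat.sub_lt (Nat.zero_lt_of_lt hm) Nat.one_pos)

/-- The multi-indices `(n_1, …, n_k)` with `1 ≤ n_i ≤ N`. -/
def indexBox (k N : ℕ) : Finset (Fin k → ℕ) :=
  Fintype.piFinset fun _ => Finset.Icc 1 N

end EntangledErgodic

/-! Everything except the last power of `T_m` is replaced by finitely many scalar-weighted vectors.
By twisted compactness, `A_j T_j^n u` is, uniformly in `n` and up to a small `L^∞` error, a finite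
sum `∑ φ_l(T_j^n u) e_l`. Iterating from `j = 1`, with joint `L^∞`-boundedness controlling earlier
errors, approximates the vectors to which the last power is applied by finite sums of `∏ i, b i (n
i) • u`, where the weights `b i` are products of orbit sequences `φ(T_j^n v)`
(`LinftyApproximable.entangledStage`). The last power contracts `L^∞`, so the error stays small
almost everywhere. For one such term the average over the box factors into one-dimensional averages:
those of `b i n * (T_m^n u)(x)` for `i = α(m)`, and those of `b i n` for the other indices.

It remains to understand the weights. Orbit sequences of a Dunford–Schwartz operator lie in a closed
algebra `goodWeights`, generated by characters `c^n`, `|c| = 1`, and sequences that are Cesàro null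
in absolute value (`IsDunfordSchwartz.orbitMap_mem_goodWeights`). On `L²` this comes from splitting
off the unimodular eigenvectors: a vector orthogonal to them is weakly mixing
(`tendsto_avg_sq_inner_pow`). On `L^p` a functional is, on bounded functions, an `L²` functional
plus one of small `L^∞` norm (`exists_functional_L2_approx`).

Such weights are good for the pointwise theorem (`IsDunfordSchwartz.weightedConverges`): a character
turns `T` into the Dunford–Schwartz operator `cT`, null weights annihilate the averages, and uniform
limits are handled by the maximal inequality. This gives convergence. If `f` is stable, the first
coefficients `φ(T_1^n f)` are Cesàro null; null sequences form an ideal, so the weight at index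
`α(1)` stays null under later multiplications, one factor of each box average tends to `0`, and the
others are bounded.

The maximal inequality is proved by a filling scheme
(`IsDunfordSchwartz.measure_exists_lt_sum_le_of_pos`), in a form that needs no positivity of `T`. -/

namespace EntangledErgodic

/-! ### Weak mixing of Hilbert space contractions off the unimodular eigenvectors -/

section Hilbert

open scoped InnerProductSpace InnerProduct

variable {H : Type*} [NormedAddCommGroup H] [InnerProductSpace ℂ H] [CompleteSpace H]

/-- Equality case of Cauchy–Schwarz: `⟪S x, c • x⟫ = ‖x‖²` while `‖S x‖ ≤ ‖x‖`, so expanding `‖S x -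
c • x‖²` gives at most `0`. -/
theorem eigenvector_of_adjoint_eigenvector {S : H →L[ℂ] H} (hS : ‖S‖ ≤ 1) {c : ℂ} (hc : ‖c‖ = 1)
    {x : H} (hx : S.adjoint x = (starRingEnd ℂ c) • x) : S x = c • x := by
  have h1 : ‖S x‖ ≤ ‖x‖ := by simpa using S.le_of_opNorm_le hS x
  have h2 : ⟪S x, c • x⟫_ℂ = (‖x‖ ^ 2 : ℝ) := by
    rw [inner_smul_right, ← ContinuousLinearMap.adjoint_inner_right, hx, inner_smul_right,
      inner_self_eq_norm_sq_to_K, ← mul_assoc, Complex.mul_conj, Complex.normSq_eq_norm_sq, hc]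
    simp
  have h3 : ‖S x - c • x‖ ^ 2 ≤ 0 := by
    rw [@norm_sub_sq ℂ, h2, norm_smul, hc]
    simp only [RCLike.re_to_complex, Complex.ofReal_re]
    nlinarith [norm_nonneg (S x), norm_nonneg x]
  have h4 : ‖S x - c • x‖ = 0 := by nlinarith [norm_nonneg (S x - c • x)]
  exact sub_eq_zero.1 (norm_eq_zero.1 h4)

omit [CompleteSpace H] in
-- Positivity is tested on the vector `‖K‖ • y - K y`, and `⟪K y, K (K y)⟫` is bounded by `‖K‖ ‖K
-- y‖²`.
theorem norm_sq_le_of_isPositive {K : H →L[ℂ] H} (hK : K.IsPositive) (y : H) :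
    ‖K y‖ ^ 2 ≤ ‖K‖ * RCLike.re ⟪y, K y⟫_ℂ := by
  rcases eq_or_ne K 0 with rfl | h0
  · simp
  have hk : 0 < ‖K‖ := norm_pos_iff.2 h0
  have hpos : ∀ z, 0 ≤ RCLike.re ⟪z, K z⟫_ℂ := fun z => hK.re_inner_nonneg_right z
  have h1 := hpos ((‖K‖ : ℂ) • y - K y)
  have hsym : ⟪y, K (K y)⟫_ℂ = ⟪K y, K y⟫_ℂ := (hK.isSymmetric y (K y)).symm
  have h2 : RCLike.re ⟪K y, K (K y)⟫_ℂ ≤ ‖K‖ * ‖K y‖ ^ 2 := by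
    calc _ ≤ ‖K y‖ * ‖K (K y)‖ := re_inner_le_norm _ _
      _ ≤ ‖K y‖ * (‖K‖ * ‖K y‖) := by gcongr; exact K.le_opNorm _
      _ = _ := by ring
  have h3 : RCLike.re ⟪K y, K y⟫_ℂ = ‖K y‖ ^ 2 := by rw [inner_self_eq_norm_sq]
  have h4 : RCLike.re ⟪(‖K‖ : ℂ) • y - K y, K ((‖K‖ : ℂ) • y - K y)⟫_ℂ =
      ‖K‖ ^ 2 * RCLike.re ⟪y, K y⟫_ℂ - 2 * ‖K‖ * ‖K y‖ ^ 2 + RCLike.re ⟪K y, K (K y)⟫_ℂ := by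
    rw [map_sub, map_smul, inner_sub_left, inner_sub_right, inner_sub_right, inner_smul_left,
      inner_smul_left, inner_smul_right, inner_smul_right, hsym, ← h3]
    simp
    ring
  rw [h4] at h1
  nlinarith

/-- A finite orthonormal set nearly attaining the supremum of the partial traces leaves little room
for the quadratic form on its orthogonal complement. Positivity turns this into a small operator
norm there, so `K` is a norm limit of the finite rank operators `K ∘ P`, with `P` projecting onto
the span. -/
theorem isCompactOperator_of_trace_le {K : H →L[ℂ] H} (hK : K.IsPositive) {C : ℝ}
    (hC : ∀ s : Finset H, Orthonormal ℂ ((↑) : s → H) → ∑ e ∈ s, RCLike.re ⟪e, K e⟫_ℂ ≤ C) :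
    IsCompactOperator K := by
  have hpos : ∀ z, 0 ≤ RCLike.re ⟪z, K z⟫_ℂ := fun z => hK.re_inner_nonneg_right z
  set A : Set ℝ := {r | ∃ s : Finset H, Orthonormal ℂ ((↑) : s → H) ∧
    r = ∑ e ∈ s, RCLike.re ⟪e, K e⟫_ℂ} with hA
  have hbdd : BddAbove A := ⟨C, by rintro _ ⟨s, hs, rfl⟩; exact hC s hs⟩
  have hne : A.Nonempty := ⟨0, ∅, by simp [Orthonormal, Pairwise], by simp⟩
  have hcl : IsClosed {f : H →L[ℂ] H | IsCompactOperator f} := isClosed_setOfPred_isCompactOperator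
  refine hcl.closure_subset (Metric.mem_closure_iff.2 fun ε hε => ?_)
  -- Chosen so that `‖K‖ δ ≤ (ε / 2)²`, which is what `norm_sq_le_of_isPositive` needs.
  set δ := (ε / 2) ^ 2 / (‖K‖ + 1) with hδ
  have hδ0 : 0 < δ := by positivity
  obtain ⟨_, ⟨s, hs, rfl⟩, hst⟩ := exists_lt_of_lt_csSup hne (sub_lt_self (sSup A) hδ0)
  set V : Submodule ℂ H := Submodule.span ℂ (s : Set H) with hV
  have : FiniteDimensional ℂ V := FiniteDimensional.span_finset ℂ s
  have hunit : ∀ x ∈ Vᗮ, ‖x‖ = 1 → RCLike.re ⟪x, K x⟫_ℂ ≤ δ := by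
    intro x hx hx1
    classical
    have hort : ∀ e ∈ s, ⟪e, x⟫_ℂ = 0 := fun e he =>
      (Submodule.mem_orthogonal _ _).1 hx e (Submodule.subset_span he)
    have hxs : x ∉ s := fun h => by
      have := hort x h
      rw [inner_self_eq_norm_sq_to_K, hx1] at this
      simp at this
    have hins : Orthonormal ℂ (Subtype.val : {y // y ∈ (insert x s : Finset H)} → H) := by
      have hs' := (orthonormal_subtype_iff_ite (𝕜 := ℂ) (s := (s : Set H))).1 hs
      refine (orthonormal_subtype_iff_ite (𝕜 := ℂ) (s := ((insert x s : Finset H) : Set H))).2 ?_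
      intro a ha b hb
      rcases Finset.mem_insert.1 ha with rfl | ha' <;> rcases Finset.mem_insert.1 hb with rfl | hb'
      · rw [inner_self_eq_norm_sq_to_K, hx1]; simp
      · rw [← inner_conj_symm, hort b hb', if_neg (by rintro rfl; exact hxs hb')]; simp
      · rw [hort a ha', if_neg (by rintro rfl; exact hxs ha')]
      · exact hs' a ha' b hb'
    have := le_csSup hbdd ⟨_, hins, rfl⟩
    rw [Finset.sum_insert hxs] at this
    linarith
  have hall : ∀ x ∈ Vᗮ, RCLike.re ⟪x, K x⟫_ℂ ≤ δ * ‖x‖ ^ 2 := by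
    intro x hx
    rcases eq_or_ne x 0 with rfl | h0
    · simp
    have hn : 0 < ‖x‖ := norm_pos_iff.2 h0
    have h1 := hunit (((‖x‖⁻¹ : ℝ) : ℂ) • x) (Submodule.smul_mem _ _ hx) (by
      rw [norm_smul, Complex.norm_real, Real.norm_of_nonneg (by positivity), inv_mul_cancel₀ hn.ne'])
    rw [map_smul, inner_smul_left, inner_smul_right, Complex.conj_ofReal, RCLike.re_to_complex,
      Complex.re_ofReal_mul, Complex.re_ofReal_mul] at h1
    rw [RCLike.re_to_complex]
    field_simp at h1
    linarith
  refine ⟨K ∘L V.starProjection, ?_, ?_⟩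
  · have h1 : IsCompactOperator (K ∘L V.subtypeL) := by
      have h2 : IsCompactOperator (id : V → V) := isCompactOperator_id_iff_finiteDimensional.2 this
      exact h2.clm_comp (K ∘L V.subtypeL)
    exact h1.comp_clm V.orthogonalProjectionOnto
  · rw [dist_eq_norm]
    refine (ContinuousLinearMap.opNorm_le_bound _ (by positivity : 0 ≤ ε / 2) fun x => ?_).trans_lt
      (half_lt_self hε)
    have h1 : (K - K ∘L V.starProjection) x = K (x - V.starProjection x) := by simp
    rw [h1]
    have h2 := hall _ (V.sub_starProjection_mem_orthogonal x)
    have h3 : ‖x - V.starProjection x‖ ≤ ‖x‖ := by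
      rw [← Submodule.starProjection_orthogonal_val]
      exact Submodule.norm_starProjection_apply_le _ x
    have h4 := norm_sq_le_of_isPositive hK (x - V.starProjection x)
    have h5 : ‖K (x - V.starProjection x)‖ ^ 2 ≤ (ε / 2 * ‖x‖) ^ 2 := by
      calc _ ≤ ‖K‖ * (δ * ‖x‖ ^ 2) := by
            refine h4.trans ?_
            gcongr
            refine h2.trans ?_
            gcongr
        _ ≤ (‖K‖ + 1) * (δ * ‖x‖ ^ 2) := by gcongr; linarith
        _ = _ := by rw [hδ]; field_simp
    exact abs_le_of_sq_le_sq' h5 (by positivity) |>.2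

/-- Each matrix coefficient stays in a compact disc, so it converges along the ultrafilter;
sesquilinearity and the bound pass to the limit, and the bounded form is represented by an operator.
-/
theorem exists_weak_limit (U : Ultrafilter ℕ) (K : ℕ → H →L[ℂ] H) {C : ℝ} (hC : ∀ n, ‖K n‖ ≤ C) :
    ∃ K' : H →L[ℂ] H, ∀ x y, Tendsto (fun n => ⟪x, K n y⟫_ℂ) U (𝓝 ⟪x, K' y⟫_ℂ) := by
  have hbd : ∀ x y n, ‖⟪K n x, y⟫_ℂ‖ ≤ C * ‖x‖ * ‖y‖ := by
    intro x y n
    refine (norm_inner_le_norm _ _).trans ?_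
    gcongr
    exact (K n).le_of_opNorm_le (hC n) x
  have hex : ∀ x y, ∃ l : ℂ, ‖l‖ ≤ C * ‖x‖ * ‖y‖ ∧ Tendsto (fun n => ⟪K n x, y⟫_ℂ) U (𝓝 l) := by
    intro x y
    obtain ⟨l, hl, hl'⟩ := (isCompact_closedBall (0 : ℂ) (C * ‖x‖ * ‖y‖)).ultrafilter_le_nhds
      (U.map fun n => ⟪K n x, y⟫_ℂ) (by
        rw [le_principal_iff]
        exact Filter.mem_map.2 (univ_mem' fun n => by simpa using hbd x y n))
    exact ⟨l, by simpa using hl, hl'⟩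
  choose B hB hBt using hex
  let B' : H →L⋆[ℂ] H →L[ℂ] ℂ := LinearMap.mkContinuous₂ (LinearMap.mk₂'ₛₗ (starRingEnd ℂ)
    (RingHom.id ℂ) B
    (fun x x' y => tendsto_nhds_unique (hBt _ _) (by
      simpa only [map_add, inner_add_left] using (hBt x y).add (hBt x' y)))
    (fun c x y => tendsto_nhds_unique (hBt _ _) (by
      simpa only [map_smul, inner_smul_left, smul_eq_mul] using (hBt x y).const_mul _))
    (fun x y y' => tendsto_nhds_unique (hBt _ _) (by
      simpa only [inner_add_right] using (hBt x y).add (hBt x y')))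
    (fun c x y => tendsto_nhds_unique (hBt _ _) (by
      simpa only [inner_smul_right, smul_eq_mul, RingHom.id_apply] using (hBt x y).const_mul c))) C
    (fun x y => hB x y)
  refine ⟨InnerProductSpace.continuousLinearMapOfBilin B', fun x y => ?_⟩
  have h1 : ⟪InnerProductSpace.continuousLinearMapOfBilin B' y, x⟫_ℂ = B y x :=
    InnerProductSpace.continuousLinearMapOfBilin_apply B' y x
  rw [← inner_conj_symm, h1]
  refine ((Complex.continuous_conj.tendsto _).comp (hBt y x)).congr fun n => ?_
  exact inner_conj_symm _ _

omit [InnerProductSpace ℂ H] [CompleteSpace H] in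
theorem norm_pow_apply_le [NormedSpace ℂ H] {S : H →L[ℂ] H} (hS : ‖S‖ ≤ 1) (n : ℕ) (x : H) :
    ‖(S ^ n) x‖ ≤ ‖x‖ := by
  induction n with
  | zero => simp
  | succ n ih =>
    rw [pow_succ']
    exact ((S.le_of_opNorm_le hS _).trans_eq (one_mul _)).trans ih

/-- A vector orthogonal to all eigenvectors with unimodular eigenvalue of a Hilbert space contraction
is weakly mixing. -/
theorem tendsto_avg_sq_inner_pow {S : H →L[ℂ] H} (hS : ‖S‖ ≤ 1) {u : H}
    (hu : ∀ (c : ℂ) (x : H), ‖c‖ = 1 → S x = c • x → ⟪x, u⟫_ℂ = 0) (v : H) :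
    Tendsto (fun N : ℕ => (N : ℝ)⁻¹ * ∑ n ∈ Finset.range N, ‖⟪v, (S ^ n) u⟫_ℂ‖ ^ 2) atTop (𝓝 0) := by
  have hSn : ∀ n (x : H), ‖(S ^ n) x‖ ≤ ‖x‖ := norm_pow_apply_le hS
  rw [tendsto_iff_ultrafilter]
  intro U hU
  -- The averages in question are the quadratic forms of these averaged rank one operators. The plan
  -- is to show that every weak ultrafilter limit `L` of them is zero.
  set K : ℕ → H →L[ℂ] H := fun N => (N : ℂ)⁻¹ • ∑ n ∈ Finset.range N,
    InnerProductSpace.rankOne ℂ ((S ^ n) u) ((S ^ n) u) with hKdef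
  have hKxy : ∀ N x y, ⟪x, K N y⟫_ℂ
      = (N : ℂ)⁻¹ * ∑ n ∈ Finset.range N, ⟪x, (S ^ n) u⟫_ℂ * ⟪(S ^ n) u, y⟫_ℂ := by
    intro N x y
    simp only [hKdef, _root_.smul_apply, _root_.sum_apply,
      InnerProductSpace.rankOne_apply, inner_smul_right, inner_sum]
    congr 1
    exact Finset.sum_congr rfl fun n _ => mul_comm _ _
  have hKxx : ∀ N x, ⟪x, K N x⟫_ℂ
      = (((N : ℝ)⁻¹ * ∑ n ∈ Finset.range N, ‖⟪x, (S ^ n) u⟫_ℂ‖ ^ 2 : ℝ) : ℂ) := by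
    intro N x
    rw [hKxy, Complex.ofReal_mul, Complex.ofReal_inv, Complex.ofReal_natCast, Complex.ofReal_sum]
    congr 1
    refine Finset.sum_congr rfl fun n _ => ?_
    rw [← inner_conj_symm ((S ^ n) u) x, Complex.mul_conj, Complex.normSq_eq_norm_sq]
  have hKn : ∀ N, ‖K N‖ ≤ ‖u‖ ^ 2 := by
    intro N
    rcases N.eq_zero_or_pos with rfl | hN
    · simp [hKdef]
    have hN' : (0 : ℝ) < N := by exact_mod_cast hN
    calc ‖K N‖ ≤ (N : ℝ)⁻¹ * ∑ n ∈ Finset.range N, ‖u‖ ^ 2 := by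
          rw [hKdef]
          refine (norm_smul_le _ _).trans ?_
          rw [norm_inv, Complex.norm_natCast]
          gcongr
          refine norm_sum_le_of_le _ fun n _ => ?_
          rw [InnerProductSpace.norm_rankOne, sq]
          gcongr <;> exact hSn n u
      _ = ‖u‖ ^ 2 := by
          rw [Finset.sum_const, Finset.card_range, nsmul_eq_mul]; field_simp
  obtain ⟨L, hL⟩ := exists_weak_limit U K hKn
  have hLre : ∀ x, Tendsto (fun N : ℕ => (N : ℝ)⁻¹ * ∑ n ∈ Finset.range N, ‖⟪x, (S ^ n) u⟫_ℂ‖ ^ 2) U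
      (𝓝 (RCLike.re ⟪x, L x⟫_ℂ)) := fun x =>
    ((Complex.continuous_re.tendsto _).comp (hL x x)).congr fun N => by
      simp only [Function.comp, hKxx, Complex.ofReal_re]
  have hLim : ∀ x, Complex.im ⟪x, L x⟫_ℂ = 0 := fun x =>
    tendsto_nhds_unique ((Complex.continuous_im.tendsto _).comp (hL x x))
      (tendsto_const_nhds.congr fun N => by simp only [Function.comp, hKxx, Complex.ofReal_im])
  have hLnn : ∀ x, 0 ≤ RCLike.re ⟪x, L x⟫_ℂ := fun x =>
    ge_of_tendsto' (hLre x) fun N => by positivity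
  have hLpos : L.IsPositive := by
    rw [ContinuousLinearMap.isPositive_iff_complex]
    intro x
    have h1 : ⟪L x, x⟫_ℂ = ⟪x, L x⟫_ℂ := by
      rw [← inner_conj_symm, Complex.conj_eq_iff_im]; exact hLim x
    rw [h1]
    exact ⟨Complex.ext (by simp) (by simp [hLim x]), hLnn x⟩
  -- Invariance `S L S* = L`: conjugating by `S` shifts the averaging window by one, so the
  -- difference telescopes to two boundary terms divided by `N`.
  have hLcomm : ∀ x y, ⟪x, S (L (S.adjoint y))⟫_ℂ = ⟪x, L y⟫_ℂ := by
    intro x y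
    rw [← ContinuousLinearMap.adjoint_inner_left]
    have hd : Tendsto (fun N => ⟪S.adjoint x, K N (S.adjoint y)⟫_ℂ - ⟪x, K N y⟫_ℂ) U (𝓝 0) := by
      refine Tendsto.mono_left ?_ hU
      have hb : Tendsto (fun N : ℕ => (N : ℝ)⁻¹ * (2 * (‖x‖ * ‖u‖ * (‖u‖ * ‖y‖)))) atTop (𝓝 0) := by
        simpa using (tendsto_inv_atTop_nhds_zero_nat (𝕜 := ℝ)).mul_const
          (2 * (‖x‖ * ‖u‖ * (‖u‖ * ‖y‖)))
      refine squeeze_zero_norm (fun N => ?_) hb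
      have hterm : ∀ n, ‖⟪x, (S ^ n) u⟫_ℂ * ⟪(S ^ n) u, y⟫_ℂ‖ ≤ ‖x‖ * ‖u‖ * (‖u‖ * ‖y‖) := by
        intro n
        rw [norm_mul]
        gcongr
        · exact (norm_inner_le_norm _ _).trans (by gcongr; exact hSn n u)
        · exact (norm_inner_le_norm _ _).trans (by gcongr; exact hSn n u)
      have hsh : ∀ n, ⟪S.adjoint x, (S ^ n) u⟫_ℂ * ⟪(S ^ n) u, S.adjoint y⟫_ℂ
          = ⟪x, (S ^ (n + 1)) u⟫_ℂ * ⟪(S ^ (n + 1)) u, y⟫_ℂ := by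
        intro n
        rw [ContinuousLinearMap.adjoint_inner_left, ContinuousLinearMap.adjoint_inner_right, pow_succ']
        rfl
      rw [hKxy, hKxy, ← mul_sub, ← Finset.sum_sub_distrib]
      simp only [hsh]
      rw [Finset.sum_range_sub (fun n => ⟪x, (S ^ n) u⟫_ℂ * ⟪(S ^ n) u, y⟫_ℂ), norm_mul, norm_inv,
        Complex.norm_natCast]
      gcongr
      refine (norm_sub_le _ _).trans ?_
      linarith [hterm N, hterm 0]
    have h2 := (hL (S.adjoint x) (S.adjoint y)).sub (hL x y)
    exact sub_eq_zero.1 (tendsto_nhds_unique h2 hd)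
  -- Bessel's inequality bounds every partial trace of `K N`, hence of `L`, by `‖u‖²`.
  have hLcpt : IsCompactOperator L := by
    refine isCompactOperator_of_trace_le hLpos (C := ‖u‖ ^ 2) fun s hs => ?_
    refine le_of_tendsto' (tendsto_finsetSum s fun e _ => hLre e) fun N => ?_
    rcases N.eq_zero_or_pos with rfl | hN
    · simp
    have hN' : (0 : ℝ) < N := by exact_mod_cast hN
    rw [← Finset.mul_sum, Finset.sum_comm, inv_mul_le_iff₀ hN']
    calc _ ≤ ∑ n ∈ Finset.range N, ‖u‖ ^ 2 := by
          refine Finset.sum_le_sum fun n _ => ?_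
          have h1 := hs.sum_inner_products_le ((S ^ n) u) (s := Finset.univ)
          rw [Finset.univ_eq_attach, Finset.sum_attach s fun e => ‖⟪e, (S ^ n) u⟫_ℂ‖ ^ 2] at h1
          refine h1.trans ?_
          gcongr
          exact hSn n u
      _ = _ := by simp
  have hLzero : L = 0 := by
    -- A nonzero compact positive `L` has `‖L‖` as eigenvalue with finite-dimensional eigenspace
    -- `V`. This space yields a unimodular eigenvector of `S`; it is orthogonal to every `S ^ n u`,
    -- which contradicts `⟪x, L x⟫ = ‖L‖ ‖x‖² > 0`.
    by_contra hne
    have hk : 0 < ‖L‖ := norm_pos_iff.2 hne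
    have hspec : Module.End.HasEigenvalue (L : Module.End ℂ H) (‖L‖ : ℂ) := by
      refine (hLcpt.hasEigenvalue_iff_mem_spectrum (by exact_mod_cast hk.ne')).2 ?_
      have : Nontrivial H := by
        obtain ⟨x, hx⟩ := DFunLike.ne_iff.1 hne
        exact ⟨L x, 0, hx⟩
      have h1 := CStarAlgebra.norm_mem_spectrum_of_nonneg (a := L)
        ((ContinuousLinearMap.nonneg_iff_isPositive L).2 hLpos)
      exact (spectrum.algebraMap_mem_iff ℂ).2 h1
    set V := Module.End.eigenspace (L : Module.End ℂ H) (‖L‖ : ℂ) with hV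
    have hmem : ∀ x, x ∈ V ↔ L x = (‖L‖ : ℂ) • x := fun x => Module.End.mem_eigenspace_iff
    have hfd : FiniteDimensional ℂ V :=
      ContinuousLinearMap.finite_dimensional_eigenspace hLcpt _ (by exact_mod_cast hk.ne')
    have hSa : ∀ x, ‖S.adjoint x‖ ≤ ‖x‖ := fun x =>
      (S.adjoint.le_of_opNorm_le ((LinearIsometryEquiv.norm_map _ S).trans_le hS) x).trans_eq (one_mul _)
    -- By invariance the form of `L` at `S* x` equals `‖L‖ ‖x‖²`, the largest value possible given
    -- `‖S* x‖ ≤ ‖x‖`; equality forces `S*` to preserve both `V` and the norm.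
    have hVS : ∀ x ∈ V, S.adjoint x ∈ V ∧ ‖S.adjoint x‖ = ‖x‖ := by
      intro x hx
      have h1 : ⟪S.adjoint x, L (S.adjoint x)⟫_ℂ = ‖L‖ * (‖x‖ : ℂ) ^ 2 := by
        rw [ContinuousLinearMap.adjoint_inner_left, hLcomm, (hmem x).1 hx, inner_smul_right,
          inner_self_eq_norm_sq_to_K]
        rfl
      have h1' : RCLike.re ⟪S.adjoint x, L (S.adjoint x)⟫_ℂ = ‖L‖ * ‖x‖ ^ 2 := by
        rw [h1]; norm_cast
      have h2 : ‖L (S.adjoint x)‖ ≤ ‖L‖ * ‖S.adjoint x‖ := L.le_opNorm _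
      have h3 : ‖L‖ * ‖x‖ ^ 2 ≤ ‖S.adjoint x‖ * ‖L (S.adjoint x)‖ := h1' ▸ re_inner_le_norm _ _
      have h4 : ‖S.adjoint x‖ = ‖x‖ := by
        refine le_antisymm (hSa x) ?_
        have : ‖L‖ * ‖x‖ ^ 2 ≤ ‖L‖ * ‖S.adjoint x‖ ^ 2 := by
          nlinarith [norm_nonneg (S.adjoint x)]
        exact abs_le_of_sq_le_sq' (le_of_mul_le_mul_left this hk) (norm_nonneg _) |>.2
      refine ⟨(hmem _).2 ?_, h4⟩
      have h5 : ‖L (S.adjoint x) - (‖L‖ : ℂ) • S.adjoint x‖ ^ 2 ≤ 0 := by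
        rw [@norm_sub_sq ℂ, inner_smul_right, ← inner_conj_symm, h1, norm_smul, Complex.norm_real,
          norm_norm, h4]
        rw [h4] at h2
        have : RCLike.re ((‖L‖ : ℂ) * (starRingEnd ℂ) (‖L‖ * (‖x‖ : ℂ) ^ 2)) = ‖L‖ ^ 2 * ‖x‖ ^ 2 := by
          rw [← Complex.ofReal_pow, ← Complex.ofReal_mul, Complex.conj_ofReal, ← Complex.ofReal_mul,
            RCLike.re_to_complex, Complex.ofReal_re]
          ring
        rw [this]
        nlinarith [norm_nonneg (L (S.adjoint x)), norm_nonneg x]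
      have h6 : ‖L (S.adjoint x) - (‖L‖ : ℂ) • S.adjoint x‖ = 0 := by
        nlinarith [norm_nonneg (L (S.adjoint x) - (‖L‖ : ℂ) • S.adjoint x)]
      exact sub_eq_zero.1 (norm_eq_zero.1 h6)
    let R : V →ₗ[ℂ] V := (S.adjoint : H →ₗ[ℂ] H).restrict fun x hx => (hVS x hx).1
    have hVnt : Nontrivial V := Submodule.nontrivial_iff_ne_bot.2 hspec
    obtain ⟨c, hc⟩ := Module.End.exists_eigenvalue R
    obtain ⟨x, hx⟩ := hc.exists_hasEigenvector
    have hxe : S.adjoint (x : H) = c • (x : H) := congrArg Subtype.val hx.apply_eq_smul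
    have hx0 : (x : H) ≠ 0 := fun h => hx.2 (Subtype.ext h)
    have hxn : 0 < ‖(x : H)‖ := norm_pos_iff.2 hx0
    have hc1 : ‖c‖ = 1 := by
      have := (hVS x x.2).2
      rw [hxe, norm_smul] at this
      exact mul_right_cancel₀ hxn.ne' (by rw [this, one_mul])
    have hSx : S (x : H) = (starRingEnd ℂ c) • (x : H) :=
      eigenvector_of_adjoint_eigenvector hS (by simpa using hc1) (by simpa using hxe)
    have hxu : ∀ n, ⟪(x : H), (S ^ n) u⟫_ℂ = 0 := by
      intro n
      have h7 : ∀ n, (S.adjoint ^ n) (x : H) = c ^ n • (x : H) := by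
        intro n
        induction n with
        | zero => simp
        | succ n ih =>
          rw [pow_succ', mul_apply_eq_comp, ih, map_smul, hxe, smul_smul, pow_succ]
      have h8 : (S ^ n).adjoint = S.adjoint ^ n := by
        simpa only [ContinuousLinearMap.star_eq_adjoint] using star_pow S n
      rw [← ContinuousLinearMap.adjoint_inner_left, h8, h7, inner_smul_left,
        hu _ _ (by simpa using hc1) hSx, mul_zero]
    have h9 : RCLike.re ⟪(x : H), L x⟫_ℂ = 0 :=
      tendsto_nhds_unique (hLre x) (tendsto_const_nhds.congr fun N => by simp only [hxu]; simp)
    rw [(hmem x).1 x.2, inner_smul_right, inner_self_eq_norm_sq_to_K] at h9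
    have h10 : ‖L‖ * ‖(x : H)‖ ^ 2 = 0 := by
      have h11 : (‖L‖ : ℂ) * (‖(x : H)‖ : ℂ) ^ 2 = ((‖L‖ * ‖(x : H)‖ ^ 2 : ℝ) : ℂ) := by push_cast; rfl
      exact (congrArg Complex.re h11).symm.trans h9
    exact (mul_pos hk (pow_pos hxn 2)).ne' h10
  simpa [hLzero] using hLre v

end Hilbert

/-! ### The maximal inequality, by a filling scheme without positivity -/

section Maximal

/-- The condition is closed in the phases, so it extends from `D` to all of them; the phases `exp(-i
arg z_i)` then make every term equal to `‖z i‖`. A countable `D` is what lets the bound be tested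
almost everywhere. -/
theorem sum_norm_le_of_forall_phase {ι : Type*} {D : Set (ι → Circle)} (hD : Dense D)
    (s : Finset ι) (z : ι → ℂ) {t : ℝ} (h : ∀ c ∈ D, ‖∑ i ∈ s, (c i : ℂ) * z i‖ ≤ t) :
    ∑ i ∈ s, ‖z i‖ ≤ t := by
  have hcl : IsClosed {c : ι → Circle | ‖∑ i ∈ s, (c i : ℂ) * z i‖ ≤ t} := by
    refine isClosed_le (Continuous.norm ?_) continuous_const
    refine continuous_finsetSum _ fun i _ => ?_
    exact (continuous_subtype_val.comp (continuous_apply i)).mul continuous_const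
  have hall : ∀ c : ι → Circle, ‖∑ i ∈ s, (c i : ℂ) * z i‖ ≤ t := fun c =>
    hcl.closure_subset_iff.2 h (hD c)
  have h1 := hall fun i => Circle.exp (-Complex.arg (z i))
  have h2 : ∀ i, (Circle.exp (-Complex.arg (z i)) : ℂ) * z i = (‖z i‖ : ℝ) := by
    intro i
    nth_rw 2 [← Complex.norm_mul_exp_arg_mul_I (z i)]
    rw [Circle.coe_exp, mul_comm, mul_assoc, ← Complex.exp_add]
    simp
  simp only [h2, ← Complex.ofReal_sum] at h1
  rwa [Complex.norm_real, Real.norm_of_nonneg (Finset.sum_nonneg fun i _ => norm_nonneg _)] at h1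

variable {X : Type*} [MeasurableSpace X] {μ : Measure X}

theorem coeFn_finsetSum_smul {p : ℝ≥0∞} {ι : Type*} (s : Finset ι) (c : ι → ℂ)
    (d : ι → Lp ℂ p μ) :
    ((∑ i ∈ s, c i • d i : Lp ℂ p μ) : X → ℂ) =ᵐ[μ] fun x => ∑ i ∈ s, c i * d i x := by
  classical
  induction s using Finset.induction_on with
  | empty =>
    simp only [Finset.sum_empty]
    exact Lp.coeFn_zero ℂ p μ
  | insert a s ha ih =>
    rw [Finset.sum_insert ha]
    filter_upwards [Lp.coeFn_add (c a • d a) (∑ i ∈ s, c i • d i), Lp.coeFn_smul (c a) (d a), ih]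
      with x h1 h2 h3
    rw [h1, Pi.add_apply, h2, h3, Finset.sum_insert ha, Pi.smul_apply, smul_eq_mul]

theorem ae_norm_le_iff_eLpNorm_top_le {f : X → ℂ} {t : ℝ} (ht : 0 ≤ t) :
    (∀ᵐ x ∂μ, ‖f x‖ ≤ t) ↔ eLpNorm f ∞ μ ≤ ENNReal.ofReal t := by
  rw [eLpNorm_exponent_top]
  refine ⟨eLpNormEssSup_le_of_ae_bound, fun h => ?_⟩
  filter_upwards [enorm_ae_le_eLpNormEssSup f μ] with x hx
  have := hx.trans h
  rwa [← ofReal_norm, ENNReal.ofReal_le_ofReal_iff ht] at this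

variable {T : Lp ℂ 1 μ →L[ℂ] Lp ℂ 1 μ}

theorem IsDunfordSchwartz.ae_norm_le (hT : IsDunfordSchwartz T) {f : Lp ℂ 1 μ} {t : ℝ}
    (ht : 0 ≤ t) (hf : ∀ᵐ x ∂μ, ‖f x‖ ≤ t) : ∀ᵐ x ∂μ, ‖T f x‖ ≤ t :=
  (ae_norm_le_iff_eLpNorm_top_le ht).2
    ((hT.eLpNorm_top_le f).trans ((ae_norm_le_iff_eLpNorm_top_le ht).1 hf))

theorem IsDunfordSchwartz.norm_le (hT : IsDunfordSchwartz T) (f : Lp ℂ 1 μ) : ‖T f‖ ≤ ‖f‖ := by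
  simpa using T.le_of_opNorm_le hT.norm_le_one f

theorem IsDunfordSchwartz.pow (hT : IsDunfordSchwartz T) (n : ℕ) : IsDunfordSchwartz (T ^ n) where
  norm_le_one := ContinuousLinearMap.opNorm_le_bound _ zero_le_one fun x => by
    rw [one_mul]; exact norm_pow_apply_le hT.norm_le_one n x
  eLpNorm_top_le f := by
    induction n with
    | zero => simp
    | succ n ih =>
      rw [pow_succ']
      exact (hT.eLpNorm_top_le _).trans ih

/-- Every phase combination `∑ c i • d i` is bounded by `t`, and so is its image under `T`.
Countably many phases recover the sum of absolute values. This plays the role that a positive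
operator dominating `T` would have. -/
theorem IsDunfordSchwartz.ae_sum_norm_le (hT : IsDunfordSchwartz T) {ι : Type*} [Countable ι]
    (s : Finset ι) (d : ι → Lp ℂ 1 μ) {t : ℝ} (ht : 0 ≤ t)
    (hd : ∀ᵐ x ∂μ, ∑ i ∈ s, ‖d i x‖ ≤ t) : ∀ᵐ x ∂μ, ∑ i ∈ s, ‖T (d i) x‖ ≤ t := by
  obtain ⟨D, hDc, hDd⟩ := TopologicalSpace.exists_countable_dense (ι → Circle)
  have hc : ∀ c ∈ D, ∀ᵐ x ∂μ, ‖∑ i ∈ s, (c i : ℂ) * T (d i) x‖ ≤ t := by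
    intro c _
    have h1 : ∀ᵐ x ∂μ, ‖(∑ i ∈ s, (c i : ℂ) • d i : Lp ℂ 1 μ) x‖ ≤ t := by
      filter_upwards [hd, coeFn_finsetSum_smul s (fun i => (c i : ℂ)) d] with x hx h2
      rw [h2]
      refine (norm_sum_le _ _).trans (le_trans (Finset.sum_le_sum fun i _ => ?_) hx)
      rw [norm_mul, Circle.norm_coe, one_mul]
    have h3 := hT.ae_norm_le ht h1
    rw [map_sum] at h3
    simp only [map_smul] at h3
    filter_upwards [h3, coeFn_finsetSum_smul s (fun i => (c i : ℂ)) fun i => T (d i)] with x hx h4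
    rwa [← h4]
  filter_upwards [(ae_ball_iff hDc).2 hc] with x hx
  exact sum_norm_le_of_forall_phase hDd s _ hx

/-- Filling a hole of capacity `t - s` with as much as possible of `f`. -/
theorem exists_fill (f : Lp ℂ 1 μ) {s : X → ℝ} (hs : Measurable s) (t : ℝ) :
    ∃ d : Lp ℂ 1 μ, (∀ᵐ x ∂μ, ‖(f - d) x‖ + ‖d x‖ = ‖f x‖) ∧
      ∀ᵐ x ∂μ, s x ≤ t → s x + ‖d x‖ ≤ t ∧ (s x + ‖d x‖ < t → d x = f x) := by
  set c : X → ℝ := fun x => min 1 (max (t - s x) 0 / ‖f x‖) with hc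
  have hc0 : ∀ x, 0 ≤ c x := fun x => le_min zero_le_one (by positivity)
  have hc1 : ∀ x, c x ≤ 1 := fun x => min_le_left _ _
  have hcm : AEStronglyMeasurable c μ := by
    have h1 : Measurable fun x => ‖f x‖ := (Lp.stronglyMeasurable f).measurable.norm
    have h2 : Measurable c := measurable_const.min (((measurable_const.sub hs).max
      measurable_const).div h1)
    exact h2.aestronglyMeasurable
  have hmem : MemLp (fun x => c x • f x) 1 μ := by
    refine (Lp.memLp f).mono (hcm.smul (Lp.aestronglyMeasurable f)) (Eventually.of_forall fun x => ?_)
    rw [norm_smul, Real.norm_of_nonneg (hc0 x)]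
    exact mul_le_of_le_one_left (norm_nonneg _) (hc1 x)
  refine ⟨hmem.toLp _, ?_, ?_⟩
  · filter_upwards [hmem.coeFn_toLp, Lp.coeFn_sub f (hmem.toLp _)] with x h1 h2
    rw [h2, Pi.sub_apply, h1]
    have : f x - c x • f x = (1 - c x) • f x := by rw [sub_smul, one_smul]
    rw [this, norm_smul, norm_smul, Real.norm_of_nonneg (hc0 x),
      Real.norm_of_nonneg (sub_nonneg.2 (hc1 x))]
    ring
  · filter_upwards [hmem.coeFn_toLp] with x h1 hx
    rw [h1, norm_smul, Real.norm_of_nonneg (hc0 x)]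
    rcases eq_or_ne (f x) 0 with h0 | h0
    · simp [h0, hx]
    have hn : 0 < ‖f x‖ := norm_pos_iff.2 h0
    have hm : max (t - s x) 0 = t - s x := max_eq_left (by linarith)
    have h2 : c x * ‖f x‖ = min ‖f x‖ (t - s x) := by
      rw [hc]; simp only
      rw [hm, min_mul_of_nonneg _ _ hn.le, one_mul, div_mul_cancel₀ _ hn.ne']
    rw [h2]
    refine ⟨by linarith [min_le_right ‖f x‖ (t - s x)], fun h => ?_⟩
    have h3 : min ‖f x‖ (t - s x) = ‖f x‖ := by
      rcases min_choice ‖f x‖ (t - s x) with h4 | h4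
      · exact h4
      · rw [h4] at h; linarith
    have h5 : c x = 1 := by
      rw [h3] at h2
      exact mul_right_cancel₀ hn.ne' (by rw [h2, one_mul])
    rw [h5, one_smul]

/-- The filling scheme for `f` with hole capacity `t`. -/
theorem exists_filling_scheme (T : Lp ℂ 1 μ →L[ℂ] Lp ℂ 1 μ) (f : Lp ℂ 1 μ) {t : ℝ} (ht : 0 ≤ t) :
    ∃ F d : ℕ → Lp ℂ 1 μ, F 0 = f ∧ (∀ n, F (n + 1) = T (F n - d n)) ∧
      (∀ n, ∀ᵐ x ∂μ, ‖(F n - d n) x‖ + ‖d n x‖ = ‖F n x‖) ∧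
      (∀ n, ∀ᵐ x ∂μ, ∑ i ∈ Finset.range n, ‖d i x‖ ≤ t) ∧
      ∀ n, ∀ᵐ x ∂μ, ∑ i ∈ Finset.range (n + 1), ‖d i x‖ < t → d n x = F n x := by
  choose D hD1 hD2 using fun (f : Lp ℂ 1 μ) (s : {s : X → ℝ // Measurable s}) =>
    exists_fill f s.2 t
  -- The state is the mass `F n` still travelling, together with the amount already deposited in the
  -- hole.
  let st : ℕ → Lp ℂ 1 μ × {s : X → ℝ // Measurable s} := fun n => Nat.rec (f, ⟨0, measurable_zero⟩)
    (fun _ a => (T (a.1 - D a.1 a.2), ⟨fun x => a.2.1 x + ‖D a.1 a.2 x‖,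
      a.2.2.add (Lp.stronglyMeasurable _).measurable.norm⟩)) n
  have hs : ∀ n x, (st n).2.1 x = ∑ i ∈ Finset.range n, ‖D (st i).1 (st i).2 x‖ := by
    intro n x
    induction n with
    | zero => rfl
    | succ n ih => rw [Finset.sum_range_succ, ← ih]
  have hle : ∀ n, ∀ᵐ x ∂μ, (st n).2.1 x ≤ t := by
    intro n
    induction n with
    | zero => exact Eventually.of_forall fun _ => ht
    | succ n ih =>
      filter_upwards [ih, hD2 (st n).1 (st n).2] with x h1 h2
      exact (h2 h1).1
  refine ⟨fun n => (st n).1, fun n => D (st n).1 (st n).2, rfl, fun n => rfl, fun n => hD1 _ _,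
    fun n => ?_, fun n => ?_⟩
  · filter_upwards [hle n] with x hx
    rwa [hs] at hx
  · filter_upwards [hle n, hD2 (st n).1 (st n).2] with x h1 h2 h3
    rw [Finset.sum_range_succ, ← hs] at h3
    exact (h2 h1).2 h3

/-- Where the hole is not full after `n` steps, all arriving mass was deposited, `F j = d j` for `j
< n`. Then `T^j f` is a sum of terms `T^l d_i` with `l + i = j`, and for fixed `l` these contribute
at most `t`, so the sum over `j < n` is at most `n t`. Thus the exceptional set lies where the hole
eventually fills, and the total deposit has norm at most `‖f‖`. -/
theorem IsDunfordSchwartz.measure_exists_lt_sum_le_of_pos (hT : IsDunfordSchwartz T) (f : Lp ℂ 1 μ)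
    {t : ℝ} (ht : 0 < t) :
    μ {x | ∃ n : ℕ, n * t < ∑ j ∈ Finset.range n, ‖(T ^ j) f x‖} ≤ ENNReal.ofReal (‖f‖ / t) := by
  obtain ⟨F, d, hF0, hF, hsplit, hle, hfull⟩ := exists_filling_scheme T f ht.le
  have hint : ∀ g : Lp ℂ 1 μ, Integrable (fun x => ‖g x‖) μ := fun g => (L1.integrable_coeFn g).norm
  have hFd : ∀ n, ‖F n - d n‖ + ‖d n‖ = ‖F n‖ := by
    intro n
    rw [L1.norm_eq_integral_norm, L1.norm_eq_integral_norm, L1.norm_eq_integral_norm,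
      ← integral_add (hint _) (hint _)]
    exact integral_congr_ae (hsplit n)
  have hsum : ∀ n, ∑ i ∈ Finset.range n, ‖d i‖ + ‖F n‖ ≤ ‖f‖ := by
    intro n
    induction n with
    | zero => simp [hF0]
    | succ n ih =>
      rw [Finset.sum_range_succ, hF]
      linarith [hFd n, hT.norm_le (F n - d n)]
  -- Unrolling the recursion: mass is either still travelling, or was deposited at time `i` and then
  -- moved `j - i` times.
  have hpow : ∀ j, (T ^ j) f = F j + ∑ i ∈ Finset.range j, (T ^ (j - i)) (d i) := by
    intro j
    induction j with
    | zero => simp [hF0]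
    | succ j ih =>
      have h1 : ∑ i ∈ Finset.range (j + 1), (T ^ (j + 1 - i)) (d i)
          = T (∑ i ∈ Finset.range j, (T ^ (j - i)) (d i)) + T (d j) := by
        rw [Finset.sum_range_succ, map_sum, Nat.add_sub_cancel_left, pow_one]
        congr 1
        refine Finset.sum_congr rfl fun i hi => ?_
        rw [Nat.succ_sub (Finset.mem_range.1 hi).le, pow_succ']
        rfl
      rw [pow_succ', mul_apply_eq_comp, ih, h1, hF, map_add, map_sub]
      abel
  have hpowx : ∀ j, ∀ᵐ x ∂μ, (T ^ j) f x = F j x + ∑ i ∈ Finset.range j, (T ^ (j - i)) (d i) x := by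
    intro j
    have h2 := coeFn_finsetSum_smul (μ := μ) (Finset.range j) (fun _ => 1)
      fun i => (T ^ (j - i)) (d i)
    simp only [one_smul, one_mul] at h2
    filter_upwards [h2, Lp.coeFn_add (F j) (∑ i ∈ Finset.range j, (T ^ (j - i)) (d i))] with x h3 h4
    rw [hpow, h4, Pi.add_apply, h3]
  have hTl : ∀ l n, ∀ᵐ x ∂μ, ∑ i ∈ Finset.range n, ‖(T ^ l) (d i) x‖ ≤ t := fun l n =>
    (hT.pow l).ae_sum_norm_le _ _ ht.le (hle n)
  set A : ℕ → Set X := fun n => {x | t ≤ ∑ i ∈ Finset.range n, ‖d i x‖} with hA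
  have hmono : Monotone A := by
    intro a b hab x hx
    exact le_trans hx (Finset.sum_le_sum_of_subset_of_nonneg (Finset.range_mono hab)
      fun i _ _ => norm_nonneg _)
  have hsub : {x | ∃ n : ℕ, n * t < ∑ j ∈ Finset.range n, ‖(T ^ j) f x‖} ≤ᵐ[μ] ⋃ n, A n := by
    filter_upwards [ae_all_iff.2 hpowx, ae_all_iff.2 fun l => ae_all_iff.2 (hTl l),
      ae_all_iff.2 hfull] with x h1 h2 h3
    rintro ⟨n, hn⟩
    refine Set.mem_iUnion.2 ⟨n, ?_⟩
    by_contra hlt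
    have hlt' : ∑ i ∈ Finset.range n, ‖d i x‖ < t := not_le.1 hlt
    refine absurd hn (not_lt.2 ?_)
    calc ∑ j ∈ Finset.range n, ‖(T ^ j) f x‖
        ≤ ∑ j ∈ Finset.range n, ∑ k ∈ Finset.range (j + 1), ‖(T ^ k) (d (j - k)) x‖ := by
          refine Finset.sum_le_sum fun j hj => ?_
          have h4 : d j x = F j x := by
            refine h3 j (lt_of_le_of_lt ?_ hlt')
            exact Finset.sum_le_sum_of_subset_of_nonneg
              (Finset.range_mono (Finset.mem_range.1 hj)) fun i _ _ => norm_nonneg _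
          have h5 : ∑ k ∈ Finset.range (j + 1), ‖(T ^ k) (d (j - k)) x‖
              = ∑ i ∈ Finset.range (j + 1), ‖(T ^ (j - i)) (d i) x‖ := by
            rw [← Finset.sum_flip]
            refine Finset.sum_congr rfl fun k hk => ?_
            rw [Nat.sub_sub_self (Nat.lt_succ_iff.1 (Finset.mem_range.1 hk))]
          rw [h5, Finset.sum_range_succ, h1 j, ← h4, Nat.sub_self, pow_zero, add_comm]
          refine (norm_add_le _ _).trans ?_
          exact add_le_add_left (norm_sum_le _ _) _
      -- Summation is regrouped by the exponent `l`, so that the deposits appear as one partial sum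
      -- under a single power of `T`.
      _ = ∑ l ∈ Finset.range n, ∑ i ∈ Finset.range (n - l), ‖(T ^ l) (d i) x‖ :=
          Finset.sum_range_diag_flip n fun l i => ‖(T ^ l) (d i) x‖
      _ ≤ ∑ l ∈ Finset.range n, t := Finset.sum_le_sum fun l _ => h2 l _
      _ = n * t := by simp
  refine (measure_mono_ae hsub).trans ?_
  rw [hmono.measure_iUnion]
  refine iSup_le fun n => ?_
  have h1 : ENNReal.ofReal t * μ (A n) ≤ ENNReal.ofReal ‖f‖ := by
    calc ENNReal.ofReal t * μ (A n)
        ≤ ENNReal.ofReal t * μ {x | ENNReal.ofReal t ≤ ENNReal.ofReal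
            (∑ i ∈ Finset.range n, ‖d i x‖)} := by
          gcongr
          exact fun _ h => ENNReal.ofReal_le_ofReal h
      _ ≤ ∫⁻ x, ENNReal.ofReal (∑ i ∈ Finset.range n, ‖d i x‖) ∂μ := by
          refine mul_meas_ge_le_lintegral ?_ _
          exact (Finset.measurable_sum _ fun i _ =>
            (Lp.stronglyMeasurable (d i)).measurable.norm).ennreal_ofReal
      _ = ENNReal.ofReal (∫ x, ∑ i ∈ Finset.range n, ‖d i x‖ ∂μ) := by
          rw [ofReal_integral_eq_lintegral_ofReal (integrable_finsetSum _ fun i _ => hint _)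
            (Eventually.of_forall fun x => Finset.sum_nonneg fun i _ => norm_nonneg _)]
      _ ≤ ENNReal.ofReal ‖f‖ := by
          refine ENNReal.ofReal_le_ofReal ?_
          rw [integral_finsetSum _ fun i _ => hint _]
          simp only [← L1.norm_eq_integral_norm]
          linarith [hsum n, norm_nonneg (F n)]
  rw [ENNReal.ofReal_div_of_pos ht]
  refine (ENNReal.le_div_iff_mul_le (Or.inl (by simpa using ht)) (Or.inl ENNReal.ofReal_ne_top)).2 ?_
  rwa [mul_comm]

/-- The maximal inequality for the averages of `|T ^ n f|`. -/
theorem IsDunfordSchwartz.measure_exists_lt_sum_le (hT : IsDunfordSchwartz T) (f : Lp ℂ 1 μ)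
    {t : ℝ} (ht : 0 < t) :
    μ {x | ∃ N : ℕ, N * t < ∑ n ∈ Finset.Icc 1 N, ‖(T ^ n) f x‖} ≤ ENNReal.ofReal (‖f‖ / t) := by
  have h1 := hT.measure_exists_lt_sum_le_of_pos (T f) ht
  have h2 : ∀ N x, ∑ n ∈ Finset.Icc 1 N, ‖(T ^ n) f x‖
      = ∑ j ∈ Finset.range N, ‖(T ^ j) (T f) x‖ := by
    intro N x
    rw [Finset.range_eq_Ico, ← Finset.Ico_add_one_right_eq_Icc,
      Finset.sum_Ico_eq_sum_range, Nat.Ico_zero_eq_range]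
    refine Finset.sum_congr (by simp) fun j _ => ?_
    rw [add_comm, pow_succ]
    rfl
  simp only [h2]
  refine h1.trans (ENNReal.ofReal_le_ofReal ?_)
  gcongr
  exact hT.norm_le f

/-- A function in the closure of `V` is approximated by elements of `V` in such a way that the
averages of `|T ^ n (u - v i)|` are uniformly small almost everywhere. -/
theorem IsDunfordSchwartz.exists_seq_of_mem_closure (hT : IsDunfordSchwartz T) {V : Set (Lp ℂ 1 μ)}
    {u : Lp ℂ 1 μ} (hu : u ∈ closure V) :
    ∃ v : ℕ → Lp ℂ 1 μ, (∀ i, v i ∈ V) ∧ ∀ᵐ x ∂μ, ∀ ε : ℝ, 0 < ε → ∃ i, ∀ N : ℕ,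
      ∑ n ∈ Finset.Icc 1 N, ‖(T ^ n) u x - (T ^ n) (v i) x‖ ≤ N * ε := by
  -- With error `4^{-i}` and threshold `2^{-i}`, the maximal inequality bounds the `i`-th bad set by
  -- `2^{-i}`, and Borel–Cantelli applies.
  have h1 : ∀ i : ℕ, ∃ v ∈ V, ‖u - v‖ ≤ (1 / 2 : ℝ) ^ i * (1 / 2 : ℝ) ^ i := fun i => by
    obtain ⟨v, hv, hd⟩ := Metric.mem_closure_iff.1 hu ((1 / 2 : ℝ) ^ i * (1 / 2 : ℝ) ^ i)
      (by positivity)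
    exact ⟨v, hv, by rw [← dist_eq_norm]; exact hd.le⟩
  choose v hv hd using h1
  refine ⟨v, hv, ?_⟩
  set B : ℕ → Set X := fun i =>
    {x | ∃ N : ℕ, N * (1 / 2 : ℝ) ^ i < ∑ n ∈ Finset.Icc 1 N, ‖(T ^ n) (u - v i) x‖} with hB
  have hBm : ∀ i, μ (B i) ≤ (1 / 2 : ℝ≥0∞) ^ i := by
    intro i
    refine (hT.measure_exists_lt_sum_le (u - v i) (by positivity)).trans ?_
    have : (1 / 2 : ℝ≥0∞) ^ i = ENNReal.ofReal ((1 / 2 : ℝ) ^ i) := by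
      rw [ENNReal.ofReal_pow (by norm_num)]
      congr 1
      rw [ENNReal.ofReal_div_of_pos (by norm_num)]; simp
    rw [this]
    refine ENNReal.ofReal_le_ofReal ?_
    rw [div_le_iff₀ (by positivity)]
    exact hd i
  have hbc : ∀ᵐ x ∂μ, ∀ᶠ i in atTop, x ∉ B i := by
    refine ae_eventually_notMem (ne_top_of_le_ne_top ?_ (ENNReal.tsum_le_tsum hBm))
    rw [ENNReal.tsum_geometric]
    simp
  have hsub : ∀ᵐ x ∂μ, ∀ i n, (T ^ n) (u - v i) x = (T ^ n) u x - (T ^ n) (v i) x := by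
    refine ae_all_iff.2 fun i => ae_all_iff.2 fun n => ?_
    rw [map_sub]
    exact Lp.coeFn_sub _ _
  filter_upwards [hbc, hsub] with x h1 h2 ε hε
  obtain ⟨j, hj⟩ := exists_pow_lt_of_lt_one hε (by norm_num : (1 / 2 : ℝ) < 1)
  obtain ⟨i, hi, hij⟩ := (h1.and (eventually_ge_atTop j)).exists
  refine ⟨i, fun N => ?_⟩
  simp only [← h2]
  have h3 : ¬ (N * (1 / 2 : ℝ) ^ i < ∑ n ∈ Finset.Icc 1 N, ‖(T ^ n) (u - v i) x‖) := fun h =>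
    hi ⟨N, h⟩
  refine (not_lt.1 h3).trans ?_
  gcongr
  exact (pow_le_pow_of_le_one (by norm_num) (by norm_num) hij).trans hj.le

end Maximal

/-! ### Limits of sequences by approximation -/

section Averages

theorem exists_tendsto_of_forall_approx {f : ℕ → ℂ}
    (h : ∀ ε : ℝ, 0 < ε → ∃ g : ℕ → ℂ, (∃ l, Tendsto g atTop (𝓝 l)) ∧ ∀ᶠ N in atTop, ‖f N - g N‖ ≤ ε) :
    ∃ l, Tendsto f atTop (𝓝 l) := by
  refine cauchySeq_tendsto_of_complete (Metric.cauchySeq_iff.2 fun ε hε => ?_)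
  obtain ⟨g, ⟨l, hl⟩, hg⟩ := h (ε / 4) (by positivity)
  obtain ⟨N₁, h1⟩ := Metric.cauchySeq_iff.1 hl.cauchySeq (ε / 4) (by positivity)
  obtain ⟨N₂, h2⟩ := eventually_atTop.1 hg
  refine ⟨max N₁ N₂, fun m hm n hn => ?_⟩
  have h3 := h1 m (le_of_max_le_left hm) n (le_of_max_le_left hn)
  have h4 := h2 m (le_of_max_le_right hm)
  have h5 := h2 n (le_of_max_le_right hn)
  rw [dist_eq_norm] at h3 ⊢
  calc ‖f m - f n‖ = ‖(f m - g m) + (g m - g n) - (f n - g n)‖ := by congr 1; ring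
    _ ≤ ‖f m - g m‖ + ‖g m - g n‖ + ‖f n - g n‖ :=
      (norm_sub_le _ _).trans (by gcongr; exact norm_add_le _ _)
    _ < ε := by linarith

theorem tendsto_zero_of_forall_approx {f : ℕ → ℝ} (hf : ∀ N, 0 ≤ f N)
    (h : ∀ ε : ℝ, 0 < ε → ∃ g : ℕ → ℝ, Tendsto g atTop (𝓝 0) ∧ ∀ᶠ N in atTop, f N ≤ g N + ε) :
    Tendsto f atTop (𝓝 0) := by
  refine Metric.tendsto_atTop'.2 fun ε hε => ?_
  obtain ⟨g, hg, hfg⟩ := h (ε / 2) (by positivity)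
  obtain ⟨N, hN⟩ := eventually_atTop.1 (hfg.and (hg.eventually_lt_const (half_pos hε)))
  refine ⟨N, fun n hn => ?_⟩
  rw [dist_zero_right, Real.norm_of_nonneg (hf n)]
  linarith [(hN n hn.le).1, (hN n hn.le).2]

theorem norm_cesaro_sub_le {a b : ℕ → ℂ} {N : ℕ} {ε : ℝ} (hε : 0 ≤ ε)
    (h : ∑ n ∈ Finset.Icc 1 N, ‖a n - b n‖ ≤ N * ε) :
    ‖(1 / (N : ℂ)) * ∑ n ∈ Finset.Icc 1 N, a n - (1 / (N : ℂ)) * ∑ n ∈ Finset.Icc 1 N, b n‖ ≤ ε := by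
  rw [← mul_sub, ← Finset.sum_sub_distrib, norm_mul, norm_div, norm_one, Complex.norm_natCast]
  rcases N.eq_zero_or_pos with rfl | hN
  · simpa using hε
  have hN' : (0 : ℝ) < N := by exact_mod_cast hN
  rw [one_div, inv_mul_le_iff₀ hN']
  exact (norm_sum_le _ _).trans h

end Averages

/-! ### Inclusions between the spaces `L^p` -/

section Inclusion

variable {X : Type*} [MeasurableSpace X] {μ : Measure X} [IsProbabilityMeasure μ]

/-- The inclusion `L^p(μ) ⊆ L^q(μ)` for `q ≤ p`. -/
noncomputable def lpInclusion {p q : ℝ≥0∞} [Fact (1 ≤ p)] [Fact (1 ≤ q)] (h : q ≤ p) :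
    Lp ℂ p μ →L[ℂ] Lp ℂ q μ :=
  LinearMap.mkContinuous
    { toFun := fun f => ⟨f.1, Lp.antitone h f.2⟩
      map_add' := fun _ _ => rfl
      map_smul' := fun _ _ => rfl } 1 (fun f => by
    rw [one_mul, Lp.norm_def, Lp.norm_def]
    exact ENNReal.toReal_mono (Lp.eLpNorm_ne_top f)
      (eLpNorm_le_eLpNorm_of_exponent_le h (Lp.aestronglyMeasurable f)))

variable {p q : ℝ≥0∞} [Fact (1 ≤ p)] [Fact (1 ≤ q)]

theorem coeFn_lpInclusion (h : q ≤ p) (f : Lp ℂ p μ) : (lpInclusion h f : X → ℂ) = f := rfl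

theorem denseRange_lpInclusion_top (hp : p ≠ ∞) :
    DenseRange (lpInclusion (μ := μ) (le_top : p ≤ ∞)) := by
  refine (Lp.simpleFunc.denseRange (E := ℂ) (μ := μ) (p := p) hp).mono ?_
  rintro _ ⟨g, rfl⟩
  have h1 : MemLp (Lp.simpleFunc.toSimpleFunc g) ∞ μ := SimpleFunc.memLp_top _ μ
  refine ⟨h1.toLp _, Lp.ext ?_⟩
  rw [coeFn_lpInclusion]
  exact h1.coeFn_toLp.trans (Lp.simpleFunc.toSimpleFunc_eq_toFun g)

variable {T : Lp ℂ 1 μ →L[ℂ] Lp ℂ 1 μ}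

theorem IsDunfordSchwartz.norm_onLp_le (hT : IsDunfordSchwartz T) (p : ℝ≥0∞) [Fact (1 ≤ p)] :
    ‖hT.onLp p‖ ≤ 1 :=
  LinearMap.mkContinuous_norm_le _ zero_le_one _

theorem IsDunfordSchwartz.lpInclusion_onLp_pow (hT : IsDunfordSchwartz T) (h : q ≤ p) (n : ℕ)
    (f : Lp ℂ p μ) : lpInclusion h ((hT.onLp p ^ n) f) = (hT.onLp q ^ n) (lpInclusion h f) := by
  induction n with
  | zero => rfl
  | succ n ih =>
    rw [pow_succ', pow_succ', mul_apply_eq_comp, mul_apply_eq_comp, ← ih]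
    rfl

theorem IsDunfordSchwartz.onLp_one (hT : IsDunfordSchwartz T) : hT.onLp 1 = T := rfl

theorem IsDunfordSchwartz.coeFn_onLp_pow (hT : IsDunfordSchwartz T) (n : ℕ) (f : Lp ℂ p μ) :
    ((hT.onLp p ^ n) f : X → ℂ) = (T ^ n) (lpInclusion Fact.out f) := by
  have := hT.lpInclusion_onLp_pow (Fact.out : 1 ≤ p) n f
  rw [hT.onLp_one] at this
  rw [← this, coeFn_lpInclusion]

end Inclusion

/-! ### The pointwise ergodic theorem, with characters and null sequences as weights -/

section Ergodic

variable {X : Type*} [MeasurableSpace X] {μ : Measure X} {T : Lp ℂ 1 μ →L[ℂ] Lp ℂ 1 μ}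

/-- Almost everywhere convergence of the weighted ergodic averages of `T ^ n u`. -/
def WeightedConverges (T : Lp ℂ 1 μ →L[ℂ] Lp ℂ 1 μ) (a : ℕ → ℂ) (u : Lp ℂ 1 μ) : Prop :=
  ∀ᵐ x ∂μ, ∃ l : ℂ, Tendsto (fun N : ℕ => (1 / (N : ℂ)) *
    ∑ n ∈ Finset.Icc 1 N, a n * (T ^ n) u x) atTop (𝓝 l)

theorem WeightedConverges.add {a : ℕ → ℂ} {u v : Lp ℂ 1 μ} (hu : WeightedConverges T a u)
    (hv : WeightedConverges T a v) : WeightedConverges T a (u + v) := by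
  have hadd : ∀ᵐ x ∂μ, ∀ n, (T ^ n) (u + v) x = (T ^ n) u x + (T ^ n) v x :=
    ae_all_iff.2 fun n => by rw [map_add]; exact Lp.coeFn_add _ _
  filter_upwards [hu, hv, hadd] with x ⟨l, hl⟩ ⟨l', hl'⟩ h
  refine ⟨l + l', (hl.add hl').congr fun N => ?_⟩
  simp only [h, mul_add, Finset.sum_add_distrib]

theorem WeightedConverges.smul {a : ℕ → ℂ} {u : Lp ℂ 1 μ} (c : ℂ) (hu : WeightedConverges T a u) :
    WeightedConverges T a (c • u) := by
  have hs : ∀ᵐ x ∂μ, ∀ n, (T ^ n) (c • u) x = c * (T ^ n) u x :=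
    ae_all_iff.2 fun n => by rw [map_smul]; exact Lp.coeFn_smul _ _
  filter_upwards [hu, hs] with x ⟨l, hl⟩ h
  refine ⟨c * l, (hl.const_mul c).congr fun N => ?_⟩
  simp only [h, Finset.mul_sum]
  exact Finset.sum_congr rfl fun n _ => by ring

/-- Banach principle: almost everywhere, the averages of `u` are uniformly close to those of some
approximant `v i`, since the averages of `|T^n (u - v i)|` are small for all `N` at once. -/
theorem IsDunfordSchwartz.isClosed_weightedConverges (hT : IsDunfordSchwartz T) {a : ℕ → ℂ} {C : ℝ}
    (ha : ∀ n, ‖a n‖ ≤ C) : IsClosed {u : Lp ℂ 1 μ | WeightedConverges T a u} := by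
  refine closure_subset_iff_isClosed.1 fun u hu => ?_
  obtain ⟨v, hv, hx⟩ := hT.exists_seq_of_mem_closure hu
  have hC : 0 ≤ C := (norm_nonneg _).trans (ha 0)
  filter_upwards [hx, ae_all_iff.2 hv] with x h1 h2
  refine exists_tendsto_of_forall_approx fun ε hε => ?_
  obtain ⟨i, hi⟩ := h1 (ε / (C + 1)) (by positivity)
  refine ⟨_, h2 i, Eventually.of_forall fun N => norm_cesaro_sub_le hε.le ?_⟩
  calc ∑ n ∈ Finset.Icc 1 N, ‖a n * (T ^ n) u x - a n * (T ^ n) (v i) x‖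
      ≤ ∑ n ∈ Finset.Icc 1 N, (C + 1) * ‖(T ^ n) u x - (T ^ n) (v i) x‖ := by
        refine Finset.sum_le_sum fun n _ => ?_
        rw [← mul_sub, norm_mul]
        gcongr
        linarith [ha n]
    _ ≤ (C + 1) * (N * (ε / (C + 1))) := by
        rw [← Finset.mul_sum]
        gcongr
        exact hi N
    _ = N * ε := by field_simp

variable [IsProbabilityMeasure μ]

theorem IsDunfordSchwartz.exists_ae_norm_pow_le (hT : IsDunfordSchwartz T) (g : Lp ℂ ∞ μ) :
    ∃ M : ℝ, 0 ≤ M ∧ ∀ᵐ x ∂μ, ∀ n, ‖(T ^ n) (lpInclusion le_top g) x‖ ≤ M := by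
  refine ⟨‖g‖, norm_nonneg _, ae_all_iff.2 fun n => (hT.pow n).ae_norm_le (norm_nonneg _) ?_⟩
  rw [coeFn_lpInclusion, ae_norm_le_iff_eLpNorm_top_le (norm_nonneg _), Lp.norm_def,
    ENNReal.ofReal_toReal (Lp.eLpNorm_ne_top g)]

theorem tendsto_one_div_mul_of_bounded {f : ℕ → ℂ} {M : ℝ} (hf : ∀ N, ‖f N‖ ≤ M) :
    Tendsto (fun N : ℕ => (1 / (N : ℂ)) * f N) atTop (𝓝 0) := by
  have hb : Tendsto (fun N : ℕ => (1 / (N : ℝ)) * M) atTop (𝓝 0) := by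
    simpa using (tendsto_one_div_atTop_nhds_zero_nat (𝕜 := ℝ)).mul_const M
  refine squeeze_zero_norm (fun N => ?_) hb
  rw [norm_mul, norm_div, norm_one, Complex.norm_natCast]
  gcongr
  exact hf N

theorem IsDunfordSchwartz.weightedConverges_coboundary (hT : IsDunfordSchwartz T) (g : Lp ℂ ∞ μ) :
    WeightedConverges T 1 (lpInclusion le_top g - T (lpInclusion le_top g)) := by
  obtain ⟨M, hM0, hM⟩ := hT.exists_ae_norm_pow_le g
  have hsub : ∀ᵐ x ∂μ, ∀ n, (T ^ n) (lpInclusion le_top g - T (lpInclusion le_top g)) x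
      = (T ^ n) (lpInclusion le_top g) x - (T ^ (n + 1)) (lpInclusion le_top g) x :=
    ae_all_iff.2 fun n => by rw [map_sub, pow_succ]; exact Lp.coeFn_sub _ _
  filter_upwards [hM, hsub] with x h1 h2
  refine ⟨0, tendsto_one_div_mul_of_bounded (M := M + M) fun N => ?_⟩
  simp only [Pi.one_apply, one_mul, h2]
  rw [← Finset.Ico_add_one_right_eq_Icc, ← neg_neg (∑ n ∈ _, _), ← Finset.sum_neg_distrib]
  simp only [neg_sub]
  rw [Finset.sum_Ico_sub (fun n => (T ^ n) (lpInclusion le_top g) x) (by omega), norm_neg]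
  exact (norm_sub_le _ _).trans (add_le_add (h1 _) (h1 _))

omit [IsProbabilityMeasure μ] in
theorem weightedConverges_of_fixed {u : Lp ℂ 1 μ} (hu : T u = u) : WeightedConverges T 1 u := by
  have hn : ∀ n, (T ^ n) u = u := fun n => by
    induction n with
    | zero => rfl
    | succ n ih => rw [pow_succ, mul_apply_eq_comp, hu, ih]
  refine Eventually.of_forall fun x => ⟨u x, tendsto_const_nhds.congr' ?_⟩
  filter_upwards [eventually_gt_atTop 0] with N hN
  have : (N : ℂ) ≠ 0 := by exact_mod_cast hN.ne'
  simp only [hn, Pi.one_apply, one_mul, Finset.sum_const, Nat.card_Icc, Nat.add_sub_cancel,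
    nsmul_eq_mul]
  field_simp

/-- The Dunford–Schwartz pointwise ergodic theorem. -/
theorem IsDunfordSchwartz.weightedConverges_one (hT : IsDunfordSchwartz T) (u : Lp ℂ 1 μ) :
    WeightedConverges T 1 u := by
  let G : Submodule ℂ (Lp ℂ 1 μ) :=
    { carrier := {u | WeightedConverges T 1 u}
      add_mem' := fun hu hv => hu.add hv
      zero_mem' := weightedConverges_of_fixed (map_zero T)
      smul_mem' := fun c _ hu => hu.smul c }
  have hG : IsClosed (G : Set (Lp ℂ 1 μ)) :=
    hT.isClosed_weightedConverges (C := 1) fun n => by simp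
  set J : Lp ℂ 2 μ →L[ℂ] Lp ℂ 1 μ := lpInclusion one_le_two
  set S := hT.onLp 2
  let G₂ : Submodule ℂ (Lp ℂ 2 μ) := G.comap (J : Lp ℂ 2 μ →ₗ[ℂ] Lp ℂ 1 μ)
  have hG₂ : IsClosed (G₂ : Set (Lp ℂ 2 μ)) := hG.preimage J.continuous
  set R := ContinuousLinearMap.id ℂ (Lp ℂ 2 μ) - S
  -- Coboundaries of bounded functions telescope; density of `L^∞` in `L²` gives all of them.
  have hran : R.range ≤ G₂ := by
    rintro _ ⟨g, rfl⟩
    have hcl : IsClosed {g : Lp ℂ 2 μ | R g ∈ G₂} := hG₂.preimage R.continuous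
    refine (denseRange_lpInclusion_top (μ := μ) (p := 2) (by simp)).induction_on
      (p := fun g => R g ∈ G₂) g hcl fun g => ?_
    exact hT.weightedConverges_coboundary g
  -- The complement of the range of `1 - S` consists of fixed vectors of `S*`, which a contraction
  -- `S` fixes as well.
  have hort : R.rangeᗮ ≤ G₂ := by
    intro x hx
    have h1 : S.adjoint x = x := by
      refine ext_inner_left ℂ fun y => ?_
      rw [ContinuousLinearMap.adjoint_inner_right]
      have h2 := (Submodule.mem_orthogonal _ _).1 hx (R y) ⟨y, rfl⟩
      rw [show R y = y - S y from rfl, inner_sub_left, sub_eq_zero] at h2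
      exact h2.symm
    have h3 : S x = x := by
      simpa using eigenvector_of_adjoint_eigenvector (hT.norm_onLp_le 2) (c := 1) (by simp)
        (by simpa using h1)
    exact weightedConverges_of_fixed (congrArg J h3)
  have htop : G₂ = ⊤ := by
    rw [eq_top_iff, ← Submodule.sup_orthogonal_of_hasOrthogonalProjection (K := R.range.topologicalClosure),
      Submodule.orthogonal_closure]
    exact sup_le (Submodule.topologicalClosure_minimal _ hran hG₂) hort
  refine (denseRange_lpInclusion_top (μ := μ) (p := 1) (by simp)).induction_on
    (p := fun u => u ∈ G) u hG fun g => ?_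
  have : lpInclusion le_top g ∈ G₂ := htop ▸ Submodule.mem_top
  exact this

omit [IsProbabilityMeasure μ] in
theorem IsDunfordSchwartz.smul (hT : IsDunfordSchwartz T) {c : ℂ} (hc : ‖c‖ = 1) :
    IsDunfordSchwartz (c • T) where
  norm_le_one := by rw [norm_smul, hc, one_mul]; exact hT.norm_le_one
  eLpNorm_top_le f := by
    have h1 : eLpNorm ((c • T) f) ∞ μ = eLpNorm (c • (T f : X → ℂ)) ∞ μ :=
      eLpNorm_congr_ae (Lp.coeFn_smul c (T f))
    rw [h1, eLpNorm_const_smul, ← ofReal_norm, hc, ENNReal.ofReal_one, one_mul]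
    exact hT.eLpNorm_top_le f

/-- The weight is absorbed into the operator: `c • T` is again Dunford–Schwartz and its powers are
`c^n T^n`. -/
theorem IsDunfordSchwartz.weightedConverges_pow (hT : IsDunfordSchwartz T) {c : ℂ} (hc : ‖c‖ = 1)
    (u : Lp ℂ 1 μ) : WeightedConverges T (fun n => c ^ n) u := by
  have hs : ∀ᵐ x ∂μ, ∀ n, ((c • T) ^ n) u x = c ^ n * (T ^ n) u x :=
    ae_all_iff.2 fun n => by rw [smul_pow]; exact Lp.coeFn_smul _ _
  filter_upwards [(hT.smul hc).weightedConverges_one u, hs] with x ⟨l, hl⟩ h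
  exact ⟨l, hl.congr fun N => by simp only [h, Pi.one_apply, one_mul]⟩

/-- Finiteness of the maximal function, obtained by comparison with a bounded function at average
distance at most `1`. It controls uniform perturbations of the weight. -/
theorem IsDunfordSchwartz.exists_ae_sum_le (hT : IsDunfordSchwartz T) (u : Lp ℂ 1 μ) :
    ∀ᵐ x ∂μ, ∃ M : ℝ, 0 ≤ M ∧ ∀ N : ℕ, ∑ n ∈ Finset.Icc 1 N, ‖(T ^ n) u x‖ ≤ N * M := by
  obtain ⟨v, hv, hx⟩ := hT.exists_seq_of_mem_closure
    (denseRange_lpInclusion_top (μ := μ) (p := 1) (by simp) u)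
  choose g hg using hv
  choose M hM0 hM using fun i => hT.exists_ae_norm_pow_le (g i)
  filter_upwards [hx, ae_all_iff.2 hM] with x h1 h2
  obtain ⟨i, hi⟩ := h1 1 one_pos
  refine ⟨1 + M i, by linarith [hM0 i], fun N => ?_⟩
  calc ∑ n ∈ Finset.Icc 1 N, ‖(T ^ n) u x‖
      ≤ ∑ n ∈ Finset.Icc 1 N, (‖(T ^ n) u x - (T ^ n) (v i) x‖ + M i) := by
        refine Finset.sum_le_sum fun n _ => ?_
        have h3 := h2 i n
        rw [hg] at h3
        have h4 := norm_sub_norm_le ((T ^ n) u x) ((T ^ n) (v i) x)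
        linarith
    _ ≤ N * (1 + M i) := by
        rw [Finset.sum_add_distrib, Finset.sum_const, Nat.card_Icc, Nat.add_sub_cancel, nsmul_eq_mul]
        linarith [hi N]

/-- Cesàro null weights annihilate the ergodic averages, even in absolute value. -/
theorem IsDunfordSchwartz.tendsto_null_weight (hT : IsDunfordSchwartz T) {a : ℕ → ℂ} {C : ℝ}
    (ha : ∀ n, ‖a n‖ ≤ C)
    (ha0 : Tendsto (fun N : ℕ => (1 / (N : ℝ)) * ∑ n ∈ Finset.Icc 1 N, ‖a n‖) atTop (𝓝 0))
    (u : Lp ℂ 1 μ) : ∀ᵐ x ∂μ, Tendsto (fun N : ℕ => (1 / (N : ℝ)) *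
      ∑ n ∈ Finset.Icc 1 N, ‖a n‖ * ‖(T ^ n) u x‖) atTop (𝓝 0) := by
  obtain ⟨v, hv, hx⟩ := hT.exists_seq_of_mem_closure
    (denseRange_lpInclusion_top (μ := μ) (p := 1) (by simp) u)
  choose g hg using hv
  choose M hM0 hM using fun i => hT.exists_ae_norm_pow_le (g i)
  have hC : 0 ≤ C := (norm_nonneg _).trans (ha 0)
  filter_upwards [hx, ae_all_iff.2 hM] with x h1 h2
  refine tendsto_zero_of_forall_approx (fun N => by positivity) fun ε hε => ?_
  obtain ⟨i, hi⟩ := h1 (ε / (C + 1)) (by positivity)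
  refine ⟨fun N => M i * ((1 / (N : ℝ)) * ∑ n ∈ Finset.Icc 1 N, ‖a n‖),
    by simpa using ha0.const_mul (M i), Eventually.of_forall fun N => ?_⟩
  -- The bounded approximant is paired with the null weight, the remainder with the bound on the
  -- weight.
  have h5 : ∑ n ∈ Finset.Icc 1 N, ‖a n‖ * ‖(T ^ n) u x‖
      ≤ M i * ∑ n ∈ Finset.Icc 1 N, ‖a n‖ + N * ε := by
    calc _ ≤ ∑ n ∈ Finset.Icc 1 N,
          (M i * ‖a n‖ + (C + 1) * ‖(T ^ n) u x - (T ^ n) (v i) x‖) := by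
          refine Finset.sum_le_sum fun n _ => ?_
          have h3 := h2 i n
          rw [hg] at h3
          have h4 := norm_sub_norm_le ((T ^ n) u x) ((T ^ n) (v i) x)
          have h6 : ‖(T ^ n) u x‖ ≤ M i + ‖(T ^ n) u x - (T ^ n) (v i) x‖ := by linarith
          have h7 : ‖a n‖ ≤ C + 1 := by linarith [ha n]
          nlinarith [norm_nonneg (a n), norm_nonneg ((T ^ n) u x - (T ^ n) (v i) x)]
      _ = M i * ∑ n ∈ Finset.Icc 1 N, ‖a n‖
          + (C + 1) * ∑ n ∈ Finset.Icc 1 N, ‖(T ^ n) u x - (T ^ n) (v i) x‖ := by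
          rw [Finset.sum_add_distrib, Finset.mul_sum, Finset.mul_sum]
      _ ≤ M i * ∑ n ∈ Finset.Icc 1 N, ‖a n‖ + (C + 1) * (N * (ε / (C + 1))) := by
          gcongr
          exact hi N
      _ = _ := by field_simp
  rcases N.eq_zero_or_pos with rfl | hN
  · simpa using hε.le
  have hN' : (0 : ℝ) < N := by exact_mod_cast hN
  calc _ ≤ (1 / (N : ℝ)) * (M i * ∑ n ∈ Finset.Icc 1 N, ‖a n‖ + N * ε) := by gcongr
    _ = _ := by field_simp

end Ergodic

open scoped BoundedContinuousFunction

/-! ### The algebra of asymptotically almost periodic sequences -/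

section Weights

/-- The bounded sequences which are Cesàro null in absolute value. -/
noncomputable def cesaroNullIdeal : Ideal (ℕ →ᵇ ℂ) where
  carrier := {a | Tendsto (fun N : ℕ => (1 / (N : ℝ)) * ∑ n ∈ Finset.Icc 1 N, ‖a n‖) atTop (𝓝 0)}
  add_mem' {a b} ha hb := by
    have hab : Tendsto (fun N : ℕ => (1 / (N : ℝ)) * ∑ n ∈ Finset.Icc 1 N, ‖a n‖
        + (1 / (N : ℝ)) * ∑ n ∈ Finset.Icc 1 N, ‖b n‖) atTop (𝓝 0) := by
      simpa only [add_zero] using Tendsto.add ha hb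
    refine squeeze_zero (fun N => by positivity) (fun N => ?_) hab
    rw [← mul_add, ← Finset.sum_add_distrib]
    gcongr
    exact norm_add_le _ _
  zero_mem' := by simp
  smul_mem' c a ha := by
    have hca : Tendsto (fun N : ℕ => ‖c‖ * ((1 / (N : ℝ)) * ∑ n ∈ Finset.Icc 1 N, ‖a n‖)) atTop
        (𝓝 0) := by
      simpa only [mul_zero] using Tendsto.const_mul ‖c‖ ha
    refine squeeze_zero (fun N => by positivity) (fun N => ?_) hca
    rw [mul_left_comm ‖c‖, Finset.mul_sum _ _ ‖c‖]
    gcongr with n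
    rw [smul_eq_mul, BoundedContinuousFunction.mul_apply, norm_mul]
    gcongr
    exact c.norm_coe_le_norm n

theorem mem_cesaroNullIdeal {a : ℕ →ᵇ ℂ} : a ∈ cesaroNullIdeal ↔
    Tendsto (fun N : ℕ => (1 / (N : ℝ)) * ∑ n ∈ Finset.Icc 1 N, ‖a n‖) atTop (𝓝 0) := Iff.rfl

/-- The unimodular characters of `ℕ`, as bounded sequences. -/
def unimodularCharacters : Set (ℕ →ᵇ ℂ) := {a | ∃ c : ℂ, ‖c‖ = 1 ∧ ∀ n, a n = c ^ n}

/-- Sums of a trigonometric polynomial and a Cesàro null sequence. -/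
noncomputable def trigPlusNull : Submodule ℂ (ℕ →ᵇ ℂ) :=
  Submodule.span ℂ unimodularCharacters ⊔ cesaroNullIdeal.restrictScalars ℂ

theorem one_mem_trigPlusNull : (1 : ℕ →ᵇ ℂ) ∈ trigPlusNull :=
  Submodule.mem_sup_left (Submodule.subset_span ⟨1, by simp, fun n => by simp⟩)

theorem mul_mem_trigPlusNull (a b : ℕ →ᵇ ℂ) (ha : a ∈ trigPlusNull) (hb : b ∈ trigPlusNull) :
    a * b ∈ trigPlusNull := by
  obtain ⟨q, hq, r, hr, rfl⟩ := Submodule.mem_sup.1 ha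
  obtain ⟨q', hq', r', hr', rfl⟩ := Submodule.mem_sup.1 hb
  have hr₀ : r ∈ cesaroNullIdeal := hr
  have hr₀' : r' ∈ cesaroNullIdeal := hr'
  -- Products of characters are characters, and every term containing a null factor falls into the
  -- ideal.
  have h1 : (q + r) * (q' + r') = q * q' + (q * r' + (q' + r') * r) := by ring
  rw [h1]
  refine add_mem (Submodule.mem_sup_left ?_) (Submodule.mem_sup_right ?_)
  · have h2 := Submodule.mul_mem_mul hq hq'
    rw [Submodule.span_mul_span] at h2
    refine Submodule.span_mono ?_ h2
    rintro _ ⟨x, ⟨c, hc, hx⟩, y, ⟨d, hd, hy⟩, rfl⟩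
    refine ⟨c * d, by rw [norm_mul, hc, hd, one_mul], fun n => ?_⟩
    simp only [BoundedContinuousFunction.mul_apply, hx, hy, mul_pow]
  · exact cesaroNullIdeal.add_mem (cesaroNullIdeal.mul_mem_left _ hr₀')
      (cesaroNullIdeal.mul_mem_left _ hr₀)

/-- The closed algebra of asymptotically almost periodic weights. -/
noncomputable def goodWeights : Subalgebra ℂ (ℕ →ᵇ ℂ) :=
  (trigPlusNull.toSubalgebra one_mem_trigPlusNull mul_mem_trigPlusNull).topologicalClosure

theorem isClosed_goodWeights : IsClosed (goodWeights : Set (ℕ →ᵇ ℂ)) :=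
  Subalgebra.isClosed_topologicalClosure _

theorem trigPlusNull_le_goodWeights {a : ℕ →ᵇ ℂ} (ha : a ∈ trigPlusNull) : a ∈ goodWeights :=
  Subalgebra.le_topologicalClosure _ (Submodule.mem_toSubalgebra.2 ha)

end Weights

/-! ### The pointwise theorem for asymptotically almost periodic weights -/

section WeightedErgodic

variable {X : Type*} [MeasurableSpace X] {μ : Measure X} [IsProbabilityMeasure μ]
  {T : Lp ℂ 1 μ →L[ℂ] Lp ℂ 1 μ}

/-- A uniformly small change of the weight changes the averages by at most that amount times the
maximal function, which is finite almost everywhere. -/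
theorem IsDunfordSchwartz.isClosed_setOf_weight (hT : IsDunfordSchwartz T) (u : Lp ℂ 1 μ) :
    IsClosed {a : ℕ →ᵇ ℂ | WeightedConverges T a u} := by
  refine closure_subset_iff_isClosed.1 fun a ha => ?_
  obtain ⟨b, hb, hab⟩ := mem_closure_iff_seq_limit.1 ha
  filter_upwards [hT.exists_ae_sum_le u, ae_all_iff.2 hb] with x ⟨M, hM0, hM⟩ h2
  refine exists_tendsto_of_forall_approx fun ε hε => ?_
  obtain ⟨i, hi⟩ := (Metric.tendsto_atTop.1 hab (ε / (M + 1)) (by positivity))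
  refine ⟨_, h2 i, Eventually.of_forall fun N => norm_cesaro_sub_le hε.le ?_⟩
  calc ∑ n ∈ Finset.Icc 1 N, ‖a n * (T ^ n) u x - b i n * (T ^ n) u x‖
      ≤ ∑ n ∈ Finset.Icc 1 N, ε / (M + 1) * ‖(T ^ n) u x‖ := by
        refine Finset.sum_le_sum fun n _ => ?_
        rw [← sub_mul, norm_mul]
        gcongr
        have := (BoundedContinuousFunction.dist_coe_le_dist n).trans_lt (hi i le_rfl)
        rw [dist_comm, dist_eq_norm] at this
        exact this.le
    _ ≤ ε / (M + 1) * (N * M) := by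
        rw [← Finset.mul_sum]
        gcongr
        exact hM N
    _ ≤ ε / (M + 1) * (N * (M + 1)) := by gcongr; linarith
    _ = N * ε := by field_simp

/-- The weighted pointwise ergodic theorem for asymptotically almost periodic weights. -/
theorem IsDunfordSchwartz.weightedConverges (hT : IsDunfordSchwartz T) {a : ℕ →ᵇ ℂ}
    (ha : a ∈ goodWeights) (u : Lp ℂ 1 μ) : WeightedConverges T a u := by
  refine (hT.isClosed_setOf_weight u).closure_subset_iff.2 ?_ ha
  let G : Submodule ℂ (ℕ →ᵇ ℂ) :=
    { carrier := {a | WeightedConverges T a u}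
      add_mem' := fun {a b} ha hb => by
        have ha' : WeightedConverges T a u := ha
        have hb' : WeightedConverges T b u := hb
        change WeightedConverges T (a + b) u
        filter_upwards [ha', hb'] with x ⟨l, hl⟩ ⟨l', hl'⟩
        refine ⟨l + l', (hl.add hl').congr fun N => ?_⟩
        rw [← mul_add, ← Finset.sum_add_distrib]
        simp only [Pi.add_apply, add_mul]
      zero_mem' := by
        change WeightedConverges T (0 : ℕ → ℂ) u
        exact Eventually.of_forall fun x => ⟨0, by simp⟩
      smul_mem' := fun c a ha => by
        have ha' : WeightedConverges T a u := ha
        change WeightedConverges T (c • (a : ℕ → ℂ)) u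
        filter_upwards [ha'] with x ⟨l, hl⟩
        refine ⟨c * l, (hl.const_mul c).congr fun N => ?_⟩
        simp only [Pi.smul_apply, smul_eq_mul, Finset.mul_sum]
        exact Finset.sum_congr rfl fun n _ => by ring }
  have hG : trigPlusNull ≤ G := by
    refine sup_le (Submodule.span_le.2 ?_) ?_
    · rintro b ⟨c, hc, hb⟩
      have h1 := hT.weightedConverges_pow hc u
      rwa [← show (b : ℕ → ℂ) = fun n => c ^ n from funext hb] at h1
    · intro b hb
      filter_upwards [hT.tendsto_null_weight (fun n => b.norm_coe_le_norm n)
        (mem_cesaroNullIdeal.1 hb) u] with x hx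
      refine ⟨0, squeeze_zero_norm (fun N => ?_) hx⟩
      rw [norm_mul, norm_div, norm_one, Complex.norm_natCast]
      gcongr
      exact (norm_sum_le _ _).trans (Finset.sum_le_sum fun n _ => (norm_mul _ _).le)
  exact fun b hb => hG (Submodule.mem_toSubalgebra.1 hb)

end WeightedErgodic

/-! ### Orbit sequences are asymptotically almost periodic -/

section Orbits

/-- The sequence `n ↦ φ (S ^ n u)`, depending linearly on `u`. -/
noncomputable def orbitMap {E : Type*} [NormedAddCommGroup E] [NormedSpace ℂ E] {S : E →L[ℂ] E}
    (hS : ‖S‖ ≤ 1) (φ : E →L[ℂ] ℂ) : E →L[ℂ] (ℕ →ᵇ ℂ) :=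
  have hb : ∀ u n, ‖φ ((S ^ n) u)‖ ≤ ‖φ‖ * ‖u‖ := fun u n =>
    (φ.le_opNorm _).trans (by gcongr; exact norm_pow_apply_le hS n u)
  LinearMap.mkContinuous
    { toFun := fun u => BoundedContinuousFunction.ofNormedAddCommGroupDiscrete
        (fun n => φ ((S ^ n) u)) (‖φ‖ * ‖u‖) (hb u)
      map_add' := fun u v => by ext n; simp
      map_smul' := fun c u => by ext n; simp } ‖φ‖
    (fun u => BoundedContinuousFunction.norm_le (by positivity) |>.2 (hb u))

theorem orbitMap_apply {E : Type*} [NormedAddCommGroup E] [NormedSpace ℂ E] {S : E →L[ℂ] E}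
    (hS : ‖S‖ ≤ 1) (φ : E →L[ℂ] ℂ) (u : E) (n : ℕ) : orbitMap hS φ u n = φ ((S ^ n) u) := rfl

theorem orbitMap_mem_cesaroNullIdeal {E : Type*} [NormedAddCommGroup E] [NormedSpace ℂ E]
    {S : E →L[ℂ] E} (hS : ‖S‖ ≤ 1) (φ : E →L[ℂ] ℂ) {u : E} (hu : u ∈ stablePart S) :
    orbitMap hS φ u ∈ cesaroNullIdeal :=
  (hu φ).2

/-- Cauchy–Schwarz: the mean is at most the root of the mean square. The shift matches averages
starting at `1`. -/
theorem tendsto_cesaro_of_sq {c : ℕ → ℂ}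
    (hc : Tendsto (fun N : ℕ => (N : ℝ)⁻¹ * ∑ n ∈ Finset.range N, ‖c (n + 1)‖ ^ 2) atTop (𝓝 0)) :
    Tendsto (fun N : ℕ => (1 / (N : ℝ)) * ∑ n ∈ Finset.Icc 1 N, ‖c n‖) atTop (𝓝 0) := by
  have h1 : Tendsto (fun N : ℕ => √((N : ℝ)⁻¹ * ∑ n ∈ Finset.range N, ‖c (n + 1)‖ ^ 2)) atTop
      (𝓝 0) := by
    have h := (Real.continuous_sqrt.tendsto 0).comp hc
    rwa [Real.sqrt_zero] at h
  refine squeeze_zero (fun N => by positivity) (fun N => ?_) h1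
  refine Real.le_sqrt_of_sq_le ?_
  rcases N.eq_zero_or_pos with rfl | hN
  · simp
  have hN' : (0 : ℝ) < N := by exact_mod_cast hN
  have h2 : ∑ n ∈ Finset.Icc 1 N, ‖c n‖ = ∑ n ∈ Finset.range N, ‖c (n + 1)‖ := by
    rw [← Finset.Ico_add_one_right_eq_Icc, Finset.sum_Ico_eq_sum_range]
    exact Finset.sum_congr (by simp) fun j _ => by rw [add_comm]
  have h3 := sq_sum_le_card_mul_sum_sq (s := Finset.range N) (f := fun n => ‖c (n + 1)‖)
  rw [Finset.card_range] at h3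
  rw [h2, mul_pow]
  calc _ ≤ (1 / (N : ℝ)) ^ 2 * (N * ∑ n ∈ Finset.range N, ‖c (n + 1)‖ ^ 2) := by gcongr
    _ = _ := by field_simp

/-- Eigenvectors give multiples of characters, vectors orthogonal to them give null sequences, and
in a Hilbert space these two parts span everything. -/
theorem orbitMap_mem_goodWeights_of_hilbert {H : Type*} [NormedAddCommGroup H]
    [InnerProductSpace ℂ H] [CompleteSpace H] {S : H →L[ℂ] H} (hS : ‖S‖ ≤ 1) (φ : H →L[ℂ] ℂ)
    (u : H) : orbitMap hS φ u ∈ goodWeights := by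
  let G : Submodule ℂ H := goodWeights.toSubmodule.comap (orbitMap hS φ : H →ₗ[ℂ] (ℕ →ᵇ ℂ))
  have hG : IsClosed (G : Set H) := isClosed_goodWeights.preimage (orbitMap hS φ).continuous
  have hrev : reversiblePart S ≤ G := by
    refine Submodule.topologicalClosure_minimal _ (Submodule.span_le.2 ?_) hG
    rintro x ⟨c, hc, hx⟩
    have hn : ∀ n, (S ^ n) x = c ^ n • x := fun n => by
      induction n with
      | zero => simp
      | succ n ih => rw [pow_succ', mul_apply_eq_comp, ih, map_smul, hx, smul_smul, pow_succ]
    let e : ℕ →ᵇ ℂ := BoundedContinuousFunction.ofNormedAddCommGroupDiscrete (fun n => c ^ n) 1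
      fun n => by rw [norm_pow, hc, one_pow]
    have he : orbitMap hS φ x = φ x • e := by
      ext n
      rw [orbitMap_apply, hn, map_smul, smul_eq_mul, mul_comm]
      rfl
    have hmem : φ x • e ∈ goodWeights := trigPlusNull_le_goodWeights
      (Submodule.smul_mem _ _ (Submodule.mem_sup_left (Submodule.subset_span ⟨c, hc, fun n => rfl⟩)))
    change orbitMap hS φ x ∈ goodWeights
    rwa [he]
  have hort : (reversiblePart S)ᗮ ≤ G := by
    intro x hx
    have hx' : ∀ (c : ℂ) (y : H), ‖c‖ = 1 → S y = c • y → inner ℂ y x = 0 := fun c y hc hy =>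
      (Submodule.mem_orthogonal _ _).1 hx y
        (Submodule.le_topologicalClosure _ (Submodule.subset_span ⟨c, hc, hy⟩))
    refine trigPlusNull_le_goodWeights (Submodule.mem_sup_right ?_)
    refine tendsto_cesaro_of_sq
      -- The representing vector is moved by `S*` so that the sum from `0` sees `S ^ (n + 1)`.
      ((tendsto_avg_sq_inner_pow hS hx' (S.adjoint ((InnerProductSpace.toDual ℂ H).symm φ))).congr
        fun N => ?_)
    congr 1
    refine Finset.sum_congr rfl fun n _ => ?_
    rw [ContinuousLinearMap.adjoint_inner_left, InnerProductSpace.toDual_symm_apply, ← mul_apply_eq_comp,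
      ← pow_succ']
    rfl
  have hclosed : IsClosed (reversiblePart S : Set H) := Submodule.isClosed_topologicalClosure _
  have : CompleteSpace (reversiblePart S) := hclosed.completeSpace_coe
  have htop : (⊤ : Submodule ℂ H) ≤ G := by
    rw [← Submodule.sup_orthogonal_of_hasOrthogonalProjection (K := reversiblePart S)]
    exact sup_le hrev hort
  exact htop (Submodule.mem_top (x := u))

variable {X : Type*} [MeasurableSpace X] {μ : Measure X} [IsProbabilityMeasure μ]

theorem norm_lpInclusion_le_of_le {p q : ℝ≥0∞} [Fact (1 ≤ p)] [Fact (1 ≤ q)] (h : q ≤ p)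
    (f : Lp ℂ p μ) : ‖lpInclusion h f‖ ≤ ‖f‖ := by
  rw [Lp.norm_def, Lp.norm_def]
  exact ENNReal.toReal_mono (Lp.eLpNorm_ne_top f)
    (eLpNorm_le_eLpNorm_of_exponent_le h (Lp.aestronglyMeasurable f))

/-- On `L^∞`, the `L^p`-norm is dominated by a small multiple of the `L^∞`-norm plus a multiple of
the `L²`-norm. -/
theorem exists_norm_lpInclusion_le {p : ℝ≥0∞} [Fact (1 ≤ p)] (hp : p ≠ ∞) {δ : ℝ} (hδ : 0 < δ) :
    ∃ K : ℝ, 0 < K ∧ ∀ g : Lp ℂ ∞ μ, ‖lpInclusion (le_top : p ≤ ∞) g‖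
      ≤ δ * ‖g‖ + K * ‖lpInclusion (le_top : 2 ≤ ∞) g‖ := by
  rcases le_or_gt p 2 with h2 | h2
  · refine ⟨1, one_pos, fun g => ?_⟩
    have := norm_lpInclusion_le_of_le h2 (lpInclusion (μ := μ) (le_top : 2 ≤ ∞) g)
    have h3 : 0 ≤ δ * ‖g‖ := by positivity
    change ‖lpInclusion (le_top : p ≤ ∞) g‖ ≤ _ at this
    linarith
  set r := p.toReal with hr
  have hr2 : 2 < r := by
    have := (ENNReal.toReal_lt_toReal (by simp) hp).2 h2
    simpa using this
  -- The constant balances two cases. If `‖g‖₂ ≤ δ^{r/2} ‖g‖_∞`, then `∫ |g|^r ≤ ‖g‖₂² ‖g‖_∞^{r-2} ≤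
  -- (δ ‖g‖_∞)^r`; otherwise `‖g‖_p ≤ ‖g‖_∞ ≤ K ‖g‖₂`.
  refine ⟨(δ ^ (r / 2))⁻¹, by positivity, fun g => ?_⟩
  set M := ‖g‖
  set N := ‖lpInclusion (le_top : 2 ≤ ∞) g‖
  have hM : 0 ≤ M := norm_nonneg _
  have hN : 0 ≤ N := norm_nonneg _
  rcases le_total N (δ ^ (r / 2) * M) with hc | hc
  · suffices h : ‖lpInclusion (le_top : p ≤ ∞) g‖ ≤ δ * M by
      have : 0 ≤ (δ ^ (r / 2))⁻¹ * N := by positivity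
      linarith
    rw [Lp.norm_def, coeFn_lpInclusion]
    refine ENNReal.toReal_le_of_le_ofReal (by positivity) ?_
    have hbd : ∀ᵐ x ∂μ, ‖g x‖ ≤ M := by
      rw [ae_norm_le_iff_eLpNorm_top_le hM, show M = _ from Lp.norm_def g,
        ENNReal.ofReal_toReal (Lp.eLpNorm_ne_top g)]
    have hN2 : ∫⁻ x, ‖g x‖ₑ ^ (2 : ℝ) ∂μ = ENNReal.ofReal (N ^ 2) := by
      have h4 : eLpNorm (lpInclusion (le_top : 2 ≤ ∞) g) 2 μ = ENNReal.ofReal N := by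
        rw [show N = _ from Lp.norm_def _, ENNReal.ofReal_toReal (Lp.eLpNorm_ne_top _)]
      rw [coeFn_lpInclusion, eLpNorm_eq_lintegral_rpow_enorm_toReal (by simp) (by simp),
        ENNReal.toReal_ofNat] at h4
      rw [ENNReal.ofReal_pow hN, ← h4, ← ENNReal.rpow_natCast, ← ENNReal.rpow_mul]
      norm_num
    rw [eLpNorm_eq_lintegral_rpow_enorm_toReal (by positivity) hp, ← hr,
      one_div, ENNReal.rpow_inv_le_iff (by positivity : 0 < r)]
    calc ∫⁻ x, ‖g x‖ₑ ^ r ∂μ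
        ≤ ∫⁻ x, ‖g x‖ₑ ^ (2 : ℝ) * ENNReal.ofReal (M ^ (r - 2)) ∂μ := by
          refine lintegral_mono_ae ?_
          filter_upwards [hbd] with x hx
          rw [← add_sub_cancel (2 : ℝ) r, ENNReal.rpow_add_of_nonneg _ _ (by norm_num) (by linarith),
            add_sub_cancel]
          gcongr
          rw [← ofReal_norm, ENNReal.ofReal_rpow_of_nonneg (norm_nonneg _) (by linarith)]
          exact ENNReal.ofReal_le_ofReal (Real.rpow_le_rpow (norm_nonneg _) hx (by linarith))
      _ = ENNReal.ofReal (N ^ 2 * M ^ (r - 2)) := by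
          rw [lintegral_mul_const' _ _ ENNReal.ofReal_ne_top, hN2, ENNReal.ofReal_mul (by positivity)]
      _ ≤ ENNReal.ofReal ((δ * M) ^ r) := by
          refine ENNReal.ofReal_le_ofReal ?_
          calc N ^ 2 * M ^ (r - 2) ≤ (δ ^ (r / 2) * M) ^ 2 * M ^ (r - 2) := by gcongr
            _ = δ ^ r * (M ^ 2 * M ^ (r - 2)) := by
              rw [mul_pow, ← Real.rpow_natCast (δ ^ (r / 2)), ← Real.rpow_mul hδ.le]
              push_cast
              rw [div_mul_cancel₀ _ two_ne_zero, mul_assoc]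
            _ = (δ * M) ^ r := by
              rw [Real.mul_rpow hδ.le hM, ← Real.rpow_natCast M, ← Real.rpow_add_of_nonneg hM
                (by norm_num) (by linarith)]
              congr 2
              push_cast; ring
      _ = ENNReal.ofReal (δ * M) ^ r :=
          (ENNReal.ofReal_rpow_of_nonneg (by positivity) (by linarith)).symm
  · have h3 : ‖lpInclusion (le_top : p ≤ ∞) g‖ ≤ M := norm_lpInclusion_le_of_le _ g
    have h4 : M ≤ (δ ^ (r / 2))⁻¹ * N := by
      rw [inv_mul_eq_div, le_div_iff₀ (by positivity)]; linarith
    have : 0 ≤ δ * M := by positivity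
    linarith

/-- A functional on `L^p` is, on `L^∞`, the sum of a functional of small `L^∞`-norm and a functional
on `L²`. -/
theorem exists_functional_L2_approx {p : ℝ≥0∞} [Fact (1 ≤ p)] (hp : p ≠ ∞)
    (φ : Lp ℂ p μ →L[ℂ] ℂ) {ε : ℝ} (hε : 0 < ε) :
    ∃ (φ₁ : Lp ℂ ∞ μ →L[ℂ] ℂ) (φ₂ : Lp ℂ 2 μ →L[ℂ] ℂ), ‖φ₁‖ ≤ ε ∧
      ∀ g : Lp ℂ ∞ μ, φ (lpInclusion le_top g) = φ₁ g + φ₂ (lpInclusion le_top g) := by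
  set δ := ε / (2 * (‖φ‖ + 1)) with hδ
  have hδ0 : 0 < δ := by positivity
  obtain ⟨K, hK, hKg⟩ := exists_norm_lpInclusion_le (μ := μ) hp hδ0
  have hδC : (δ : ℂ) ≠ 0 := by exact_mod_cast hδ0.ne'
  -- Under the embedding `g ↦ (δ g, K g)` into `L^∞ × L²`, `φ` becomes a functional of norm at most
  -- `2‖φ‖` on the range. A Hahn–Banach extension then splits into its two components, and the first
  -- carries the factor `δ`, with `2‖φ‖δ ≤ ε`.
  set j : Lp ℂ ∞ μ →L[ℂ] Lp ℂ ∞ μ × Lp ℂ 2 μ :=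
    ((δ : ℂ) • ContinuousLinearMap.id ℂ _).prod ((K : ℂ) • lpInclusion le_top) with hj
  let F : j.range →ₗ[ℂ] ℂ :=
    ((φ ∘L lpInclusion le_top : Lp ℂ ∞ μ →L[ℂ] ℂ) : Lp ℂ ∞ μ →ₗ[ℂ] ℂ) ∘ₗ
      ((δ : ℂ)⁻¹ • LinearMap.fst ℂ _ _) ∘ₗ j.range.subtype
  have hFj : ∀ g, F ⟨j g, ⟨g, rfl⟩⟩ = φ (lpInclusion le_top g) := by
    intro g
    change φ (lpInclusion le_top ((δ : ℂ)⁻¹ • ((δ : ℂ) • g))) = _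
    rw [smul_smul, inv_mul_cancel₀ hδC, one_smul]
  have hFb : ∀ z, ‖F z‖ ≤ 2 * ‖φ‖ * ‖z‖ := by
    rintro ⟨_, ⟨g, rfl⟩⟩
    change ‖F ⟨j g, ⟨g, rfl⟩⟩‖ ≤ 2 * ‖φ‖ * ‖j g‖
    rw [hFj]
    have h1 : δ * ‖g‖ ≤ ‖j g‖ := by
      have : ‖(j g).1‖ ≤ ‖j g‖ := norm_fst_le _
      rwa [show (j g).1 = (δ : ℂ) • g from rfl, norm_smul, Complex.norm_real,
        Real.norm_of_nonneg hδ0.le] at this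
    have h2 : K * ‖lpInclusion (le_top : 2 ≤ ∞) g‖ ≤ ‖j g‖ := by
      have : ‖(j g).2‖ ≤ ‖j g‖ := norm_snd_le _
      rwa [show (j g).2 = (K : ℂ) • lpInclusion le_top g from rfl, norm_smul, Complex.norm_real,
        Real.norm_of_nonneg hK.le] at this
    calc _ ≤ ‖φ‖ * ‖lpInclusion (le_top : p ≤ ∞) g‖ := φ.le_opNorm _
      _ ≤ ‖φ‖ * (2 * ‖j g‖) := by gcongr; linarith [hKg g]
      _ = _ := by ring
  obtain ⟨G, hG, hGn⟩ := exists_extension_norm_eq (𝕜 := ℂ) j.range (F.mkContinuous _ hFb)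
  have hGle : ‖G‖ ≤ 2 * ‖φ‖ := hGn.trans_le (LinearMap.mkContinuous_norm_le _ (by positivity) _)
  refine ⟨(δ : ℂ) • (G ∘L ContinuousLinearMap.inl ℂ _ _), (K : ℂ) • (G ∘L ContinuousLinearMap.inr ℂ _ _),
    ?_, fun g => ?_⟩
  · rw [norm_smul, Complex.norm_real, Real.norm_of_nonneg hδ0.le]
    have h3 : ‖G ∘L ContinuousLinearMap.inl ℂ (Lp ℂ ∞ μ) (Lp ℂ 2 μ)‖ ≤ 2 * ‖φ‖ := by
      refine ContinuousLinearMap.opNorm_le_bound _ (by positivity) fun g => ?_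
      have h4 := G.le_of_opNorm_le hGle (ContinuousLinearMap.inl ℂ (Lp ℂ ∞ μ) (Lp ℂ 2 μ) g)
      simpa using h4
    calc δ * _ ≤ δ * (2 * (‖φ‖ + 1)) := by gcongr; linarith
      _ = ε := by rw [hδ]; field_simp
  · rw [← hFj]
    have h5 := hG ⟨j g, ⟨g, rfl⟩⟩
    change G (j g) = F _ at h5
    rw [← h5]
    have h6 : j g = (δ : ℂ) • ContinuousLinearMap.inl ℂ (Lp ℂ ∞ μ) (Lp ℂ 2 μ) g
        + (K : ℂ) • ContinuousLinearMap.inr ℂ (Lp ℂ ∞ μ) (Lp ℂ 2 μ) (lpInclusion le_top g) := by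
      refine Prod.ext ?_ ?_
      · change (δ : ℂ) • g = (δ : ℂ) • g + (K : ℂ) • (0 : Lp ℂ ∞ μ)
        rw [smul_zero, add_zero]
      · change (K : ℂ) • lpInclusion le_top g = (δ : ℂ) • (0 : Lp ℂ 2 μ) + (K : ℂ) • lpInclusion le_top g
        rw [smul_zero, zero_add]
    rw [h6, map_add, map_smul, map_smul]
    rfl

/-- The sequence `n ↦ φ (T ^ n u)` is asymptotically almost periodic. -/
theorem IsDunfordSchwartz.orbitMap_mem_goodWeights {T : Lp ℂ 1 μ →L[ℂ] Lp ℂ 1 μ}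
    (hT : IsDunfordSchwartz T) {p : ℝ≥0∞} [Fact (1 ≤ p)] (hp : p ≠ ∞) (φ : Lp ℂ p μ →L[ℂ] ℂ)
    (u : Lp ℂ p μ) : orbitMap (hT.norm_onLp_le p) φ u ∈ goodWeights := by
  refine (denseRange_lpInclusion_top (μ := μ) hp).induction_on
    (p := fun u => orbitMap (hT.norm_onLp_le p) φ u ∈ goodWeights) u
    (isClosed_goodWeights.preimage (orbitMap _ φ).continuous) fun g => ?_
  refine isClosed_goodWeights.closure_subset (Metric.mem_closure_iff.2 fun ε hε => ?_)
  -- Since `T` contracts `L^∞`, the `φ₁` part of the orbit sequence is at most `ε / 2` uniformly in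
  -- `n`; the `φ₂` part is covered by the Hilbert space case.
  obtain ⟨φ₁, φ₂, h1, h2⟩ := exists_functional_L2_approx hp φ
    (by positivity : 0 < ε / (2 * (‖g‖ + 1)))
  refine ⟨_, orbitMap_mem_goodWeights_of_hilbert (hT.norm_onLp_le 2) φ₂ (lpInclusion le_top g), ?_⟩
  rw [dist_eq_norm]
  refine lt_of_le_of_lt ((BoundedContinuousFunction.norm_le (half_pos hε).le).2 fun n => ?_)
    (half_lt_self hε)
  rw [BoundedContinuousFunction.sub_apply, orbitMap_apply, orbitMap_apply,
    ← hT.lpInclusion_onLp_pow, ← hT.lpInclusion_onLp_pow, h2, add_sub_cancel_right]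
  calc _ ≤ ε / (2 * (‖g‖ + 1)) * ‖(hT.onLp ∞ ^ n) g‖ := φ₁.le_of_opNorm_le h1 _
    _ ≤ ε / (2 * (‖g‖ + 1)) * (‖g‖ + 1) := by
      gcongr
      linarith [norm_pow_apply_le (hT.norm_onLp_le ∞) n g]
    _ = ε / 2 := by field_simp

end Orbits

/-! ### Product weights on multi-indices -/

section ProductWeights

variable {k : ℕ}

/-- The product weight `n ↦ ∏ i, b i (n i)`. -/
noncomputable def productWeight (b : Fin k → (ℕ →ᵇ ℂ)) (n : Fin k → ℕ) : ℂ := ∏ i, b i (n i)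

theorem norm_productWeight_le (b : Fin k → (ℕ →ᵇ ℂ)) (n : Fin k → ℕ) :
    ‖productWeight b n‖ ≤ ∏ i, ‖b i‖ := by
  rw [productWeight, norm_prod]
  exact Finset.prod_le_prod (fun i _ => norm_nonneg _) fun i _ => (b i).norm_coe_le_norm _

theorem productWeight_one (n : Fin k → ℕ) : productWeight 1 n = 1 := by simp [productWeight]

theorem productWeight_mul_mulSingle (b : Fin k → (ℕ →ᵇ ℂ)) (i : Fin k) (c : ℕ →ᵇ ℂ)
    (n : Fin k → ℕ) : productWeight (b * Pi.mulSingle i c) n = productWeight b n * c (n i) := by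
  simp only [productWeight, Pi.mul_apply, BoundedContinuousFunction.mul_apply,
    Finset.prod_mul_distrib]
  congr 1
  rw [Finset.prod_eq_single i]
  · rw [Pi.mulSingle_eq_same]
  · intro j _ hj
    rw [Pi.mulSingle_eq_of_ne hj]; rfl
  · simp

variable {E : Type*} [AddCommGroup E] [Module ℂ E]

/-- The span of the functions `n ↦ productWeight b n • u` with `b ∈ B`. -/
def weightedSpan (B : Set (Fin k → (ℕ →ᵇ ℂ))) (E : Type*) [AddCommGroup E] [Module ℂ E] :
    Submodule ℂ ((Fin k → ℕ) → E) :=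
  Submodule.span ℂ {h | ∃ b ∈ B, ∃ u : E, h = fun n => productWeight b n • u}

theorem smul_mem_weightedSpan {B : Set (Fin k → (ℕ →ᵇ ℂ))} {b : Fin k → (ℕ →ᵇ ℂ)} (hb : b ∈ B)
    (u : E) : (fun n => productWeight b n • u) ∈ weightedSpan B E :=
  Submodule.subset_span ⟨b, hb, u, rfl⟩

end ProductWeights

/-! ### Uniform approximation of the entangled products -/

section Approximation

variable {X : Type*} [MeasurableSpace X] {μ : Measure X} {p : ℝ≥0∞} [Fact (1 ≤ p)] {k : ℕ}

/-- Uniform approximability in `L^∞` by elements of `weightedSpan B`. -/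
def LinftyApproximable (B : Set (Fin k → (ℕ →ᵇ ℂ))) (h : (Fin k → ℕ) → Lp ℂ p μ) : Prop :=
  ∀ ε : ℝ, 0 < ε → ∃ g ∈ weightedSpan B (Lp ℂ p μ), ∀ n : Fin k → ℕ, (∀ i, 1 ≤ n i) →
    eLpNorm (h n - g n : Lp ℂ p μ) ∞ μ ≤ ENNReal.ofReal ε

omit [Fact (1 ≤ p)] in
theorem eLpNorm_top_add_le {f g : Lp ℂ p μ} {a b : ℝ} (ha : 0 ≤ a) (hb : 0 ≤ b)
    (hf : eLpNorm f ∞ μ ≤ ENNReal.ofReal a) (hg : eLpNorm g ∞ μ ≤ ENNReal.ofReal b) :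
    eLpNorm (f + g : Lp ℂ p μ) ∞ μ ≤ ENNReal.ofReal (a + b) := by
  rw [eLpNorm_congr_ae (Lp.coeFn_add f g), ENNReal.ofReal_add ha hb]
  exact (eLpNorm_add_le (Lp.aestronglyMeasurable f) (Lp.aestronglyMeasurable g) le_top).trans
    (add_le_add hf hg)

omit [Fact (1 ≤ p)] in
theorem eLpNorm_top_smul_le (c : ℂ) {f : Lp ℂ p μ} {a C : ℝ} (hC : ‖c‖ ≤ C) (hC0 : 0 ≤ C)
    (hf : eLpNorm f ∞ μ ≤ ENNReal.ofReal a) :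
    eLpNorm (c • f : Lp ℂ p μ) ∞ μ ≤ ENNReal.ofReal (C * a) := by
  rw [eLpNorm_congr_ae (Lp.coeFn_smul c f), eLpNorm_const_smul, ENNReal.ofReal_mul hC0, ← ofReal_norm]
  gcongr

omit [Fact (1 ≤ p)] in
theorem LinftyApproximable.of_mem {B : Set (Fin k → (ℕ →ᵇ ℂ))} {h : (Fin k → ℕ) → Lp ℂ p μ}
    (hh : h ∈ weightedSpan B (Lp ℂ p μ)) : LinftyApproximable B h := fun ε _ =>
  ⟨h, hh, fun n _ => by rw [sub_self, eLpNorm_congr_ae (Lp.coeFn_zero ℂ p μ)]; simp⟩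

omit [Fact (1 ≤ p)] in
theorem LinftyApproximable.add {B : Set (Fin k → (ℕ →ᵇ ℂ))} {h h' : (Fin k → ℕ) → Lp ℂ p μ}
    (hh : LinftyApproximable B h) (hh' : LinftyApproximable B h') :
    LinftyApproximable B (h + h') := by
  intro ε hε
  obtain ⟨g, hg, hgn⟩ := hh (ε / 2) (half_pos hε)
  obtain ⟨g', hg', hgn'⟩ := hh' (ε / 2) (half_pos hε)
  refine ⟨g + g', add_mem hg hg', fun n hn => ?_⟩
  rw [Pi.add_apply, Pi.add_apply, add_sub_add_comm, ← add_halves ε]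
  exact eLpNorm_top_add_le (half_pos hε).le (half_pos hε).le (hgn n hn) (hgn' n hn)

omit [Fact (1 ≤ p)] in
theorem LinftyApproximable.smul {B : Set (Fin k → (ℕ →ᵇ ℂ))} {h : (Fin k → ℕ) → Lp ℂ p μ}
    (c : ℂ) (hh : LinftyApproximable B h) : LinftyApproximable B (c • h) := by
  intro ε hε
  obtain ⟨g, hg, hgn⟩ := hh (ε / (‖c‖ + 1)) (by positivity)
  refine ⟨c • g, Submodule.smul_mem _ _ hg, fun n hn => ?_⟩
  rw [Pi.smul_apply, Pi.smul_apply, ← smul_sub]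
  have := eLpNorm_top_smul_le c (C := ‖c‖ + 1) (by linarith) (by positivity) (hgn n hn)
  rwa [mul_div_cancel₀ _ (by positivity)] at this

omit [Fact (1 ≤ p)] in
theorem LinftyApproximable.of_forall_approx {B : Set (Fin k → (ℕ →ᵇ ℂ))}
    {h : (Fin k → ℕ) → Lp ℂ p μ} (hh : ∀ ε : ℝ, 0 < ε → ∃ h', LinftyApproximable B h' ∧
      ∀ n : Fin k → ℕ, (∀ i, 1 ≤ n i) → eLpNorm (h n - h' n : Lp ℂ p μ) ∞ μ ≤ ENNReal.ofReal ε) :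
    LinftyApproximable B h := by
  intro ε hε
  obtain ⟨h', hB, hn'⟩ := hh (ε / 2) (half_pos hε)
  obtain ⟨g, hg, hgn⟩ := hB (ε / 2) (half_pos hε)
  refine ⟨g, hg, fun n hn => ?_⟩
  rw [← sub_add_sub_cancel (h n) (h' n) (g n), ← add_halves ε]
  exact eLpNorm_top_add_le (half_pos hε).le (half_pos hε).le (hn' n hn) (hgn n hn)

variable {m : ℕ} {S : Fin m → Lp ℂ p μ →L[ℂ] Lp ℂ p μ} {A : Fin (m - 1) → Lp ℂ p μ →L[ℂ] Lp ℂ p μ}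

/-- The component in `U` is expanded in a basis. Its coordinates are continuous functionals of `T^n
u`, because the projection onto a finite-dimensional space along a closed complement is continuous.
-/
theorem TwistedCompactness.exists_finite_approx (hA : TwistedCompactness S A) (j : Fin (m - 1))
    (u : Lp ℂ p μ) {ε : ℝ} (hε : 0 < ε) :
    ∃ (d : ℕ) (φ : Fin d → (Lp ℂ p μ →L[ℂ] ℂ)) (e : Fin d → Lp ℂ p μ), ∀ n : ℕ, 1 ≤ n →
      eLpNorm (A j ((S (j.castLE (Nat.sub_le m 1)) ^ n) u)
        - ∑ l, φ l ((S (j.castLE (Nat.sub_le m 1)) ^ n) u) • e l : Lp ℂ p μ) ∞ μ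
        ≤ ENNReal.ofReal ε := by
  obtain ⟨U, R, hRU, hR, hU, -, hn⟩ := hA u j ε hε
  have htop : Submodule.IsTopCompl R U := Submodule.IsCompl.isTopCompl_of_isClosed_of_finiteDimensional hRU hR
  let b := Module.finBasis ℂ U
  let P : Lp ℂ p μ →L[ℂ] U := U.projectionOntoL R htop.symm
  refine ⟨_, fun l => (LinearMap.toContinuousLinearMap (b.coord l)) ∘L P ∘L A j,
    fun l => (b l : Lp ℂ p μ), fun n h1 => ?_⟩
  refine le_of_eq_of_le ?_ (hn n h1).le
  set y := A j ((S (j.castLE (Nat.sub_le m 1)) ^ n) u)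
  have h2 : ∑ l, b.repr (P y) l • (b l : Lp ℂ p μ) = P y := by
    have h3 := congrArg Subtype.val (b.sum_repr (P y))
    rwa [Submodule.coe_sum] at h3
  have h4 : R.projection U hRU y = y - P y := by
    rw [eq_sub_iff_add_eq]
    exact Submodule.projection_add_projection_eq_self hRU y
  change _ = eLpNorm (R.projection U hRU y : Lp ℂ p μ) ∞ μ
  rw [h4, ← h2]
  rfl

/-- Propagation of approximability through operators `L n` depending on one of the indices. -/
theorem LinftyApproximable.map {B : Set (Fin k → (ℕ →ᵇ ℂ))} {i : Fin k}
    {L : ℕ → Lp ℂ p μ →L[ℂ] Lp ℂ p μ} {C : ℝ} (hC : 0 < C)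
    (hLC : ∀ n, 1 ≤ n → ∀ v, eLpNorm (L n v) ∞ μ ≤ ENNReal.ofReal C * eLpNorm v ∞ μ)
    (hL : ∀ b ∈ B, ∀ u, LinftyApproximable B fun n => L (n i) (productWeight b n • u))
    {h : (Fin k → ℕ) → Lp ℂ p μ} (hh : LinftyApproximable B h) :
    LinftyApproximable B fun n => L (n i) (h n) := by
  have hspan : ∀ g ∈ weightedSpan B (Lp ℂ p μ), LinftyApproximable B fun n => L (n i) (g n) := by
    intro g hg
    induction hg using Submodule.span_induction with
    | mem g hg =>
      obtain ⟨b, hb, u, rfl⟩ := hg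
      exact hL b hb u
    | zero =>
      simp only [Pi.zero_apply, map_zero]
      exact LinftyApproximable.of_mem (Submodule.zero_mem _)
    | add g g' _ _ h1 h2 =>
      simp only [Pi.add_apply, map_add]
      exact h1.add h2
    | smul c g _ h1 =>
      simp only [Pi.smul_apply, map_smul]
      exact h1.smul c
  refine LinftyApproximable.of_forall_approx fun ε hε => ?_
  obtain ⟨g, hg, hgn⟩ := hh (ε / C) (by positivity)
  refine ⟨_, hspan g hg, fun n hn => ?_⟩
  rw [← map_sub]
  refine (hLC (n i) (hn i) _).trans ?_
  calc _ ≤ ENNReal.ofReal C * ENNReal.ofReal (ε / C) := by gcongr; exact hgn n hn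
    _ = ENNReal.ofReal ε := by rw [← ENNReal.ofReal_mul hC.le, mul_div_cancel₀ _ hC.ne']

omit [Fact (1 ≤ p)] in
-- Multiplying by a scalar sequence in `n i` alters only the `i`-th factor of the product weight,
-- and the given weight is bounded, so the error is rescaled by its bound.
theorem linftyApproximable_productWeight_smul {B : Set (Fin k → (ℕ →ᵇ ℂ))}
    {b : Fin k → (ℕ →ᵇ ℂ)} {i : Fin k} {y : ℕ → Lp ℂ p μ}
    (hy : ∀ ε : ℝ, 0 < ε → ∃ (d : ℕ) (c : Fin d → (ℕ →ᵇ ℂ)) (e : Fin d → Lp ℂ p μ),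
      (∀ l, b * Pi.mulSingle i (c l) ∈ B) ∧ ∀ n, 1 ≤ n →
        eLpNorm (y n - ∑ l, c l n • e l : Lp ℂ p μ) ∞ μ ≤ ENNReal.ofReal ε) :
    LinftyApproximable B fun n => productWeight b n • y (n i) := by
  intro ε hε
  have hK : 0 ≤ ∏ i, ‖b i‖ := Finset.prod_nonneg fun i _ => norm_nonneg _
  obtain ⟨d, c, e, hcB, hde⟩ := hy (ε / (∏ i, ‖b i‖ + 1)) (by positivity)
  have hmem : ∀ l, (fun n => productWeight (b * Pi.mulSingle i (c l)) n • e l)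
      ∈ weightedSpan B (Lp ℂ p μ) := fun l => smul_mem_weightedSpan (hcB l) (e l)
  refine ⟨_, Submodule.sum_mem (t := Finset.univ) _ fun l _ => hmem l, fun n hn => ?_⟩
  have h1 := eLpNorm_top_smul_le (productWeight b n) (C := ∏ i, ‖b i‖ + 1)
    ((norm_productWeight_le b n).trans (by linarith)) (by linarith) (hde (n i) (hn i))
  rw [mul_div_cancel₀ _ (by linarith)] at h1
  have h2 : ∑ l, productWeight (b * Pi.mulSingle i (c l)) n • e l = productWeight b n •
      ∑ l, c l (n i) • e l := by
    rw [Finset.smul_sum]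
    refine Finset.sum_congr rfl fun l _ => ?_
    rw [productWeight_mul_mulSingle, smul_smul]
  rwa [Finset.sum_apply, h2, ← smul_sub]

theorem TwistedCompactness.linftyApproximable (hA : TwistedCompactness S A) (j : Fin (m - 1))
    {B : Set (Fin k → (ℕ →ᵇ ℂ))} {b : Fin k → (ℕ →ᵇ ℂ)} {i : Fin k} {u : Lp ℂ p μ}
    (hB : ∀ φ : Lp ℂ p μ →L[ℂ] ℂ, ∃ c : ℕ →ᵇ ℂ,
      (∀ n, c n = φ ((S (j.castLE (Nat.sub_le m 1)) ^ n) u)) ∧ b * Pi.mulSingle i c ∈ B) :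
    LinftyApproximable B fun n =>
      productWeight b n • A j ((S (j.castLE (Nat.sub_le m 1)) ^ n i) u) := by
  refine linftyApproximable_productWeight_smul
    (y := fun n => A j ((S (j.castLE (Nat.sub_le m 1)) ^ n) u)) fun ε hε => ?_
  obtain ⟨d, φ, e, hde⟩ := hA.exists_finite_approx j u hε
  choose c hc hcB using fun l => hB (φ l)
  refine ⟨d, c, e, hcB, fun n hn => ?_⟩
  simp only [hc]
  exact hde n hn

variable {α : Fin m → Fin k}

/-- Induction on the stage: joint boundedness carries the previous error through the next operators,
and twisted compactness rewrites their action on each fixed vector as a finite sum. `hB` says that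
`B` absorbs the orbit coefficients that appear. -/
theorem LinftyApproximable.entangledStage (hA1 : TwistedCompactness S A)
    (hA2 : JointLinftyBounded S A) {B : Set (Fin k → (ℕ →ᵇ ℂ))}
    (hB : ∀ j, ∀ i, ∀ b ∈ B, ∀ φ : Lp ℂ p μ →L[ℂ] ℂ, ∀ u, ∃ c : ℕ →ᵇ ℂ,
      (∀ n, c n = φ ((S j ^ n) u)) ∧ b * Pi.mulSingle i c ∈ B)
    {f : Lp ℂ p μ} (h0 : ∀ hm : 0 < m - 1, LinftyApproximable B fun n =>
      A ⟨0, hm⟩ ((S ⟨0, by omega⟩ ^ n (α ⟨0, by omega⟩)) f)) (j : ℕ) (hj : j < m - 1) :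
    LinftyApproximable B fun n =>
      A ⟨j, hj⟩ (EntangledErgodic.entangledStage S A α n f j (by omega)) := by
  induction j with
  | zero => exact h0 hj
  | succ j ih =>
    obtain ⟨C, hC, hCn⟩ := hA2
    refine (ih (by omega)).map (i := α ⟨j + 1, by omega⟩)
      (L := fun l => A ⟨j + 1, hj⟩ ∘L S ⟨j + 1, by omega⟩ ^ l) hC (hCn ⟨j + 1, hj⟩) fun b hb u => ?_
    simp only [map_smul]
    exact hA1.linftyApproximable ⟨j + 1, hj⟩ fun φ => hB _ _ b hb φ u

end Approximation

/-! ### Averages over boxes of multi-indices -/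

section BoxAverages

variable {k : ℕ}

theorem one_le_of_mem_indexBox {N : ℕ} {n : Fin k → ℕ} (hn : n ∈ indexBox k N) (i : Fin k) :
    1 ≤ n i :=
  (Finset.mem_Icc.1 (Fintype.mem_piFinset.1 hn i)).1

theorem card_indexBox (k N : ℕ) : (indexBox k N).card = N ^ k := by
  simp [indexBox, Fintype.card_piFinset]

theorem boxAverage_prod {R : Type*} [Field R] (F : Fin k → ℕ → R) (N : ℕ) :
    (1 / (N : R) ^ k) * ∑ n ∈ indexBox k N, ∏ i, F i (n i)
      = ∏ i, (1 / (N : R)) * ∑ n ∈ Finset.Icc 1 N, F i n := by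
  rw [indexBox, ← Finset.prod_univ_sum, Finset.prod_mul_distrib, Finset.prod_const,
    Finset.card_univ, Fintype.card_fin, one_div_pow]

theorem boxAverage_const_le {ε : ℝ} (hε : 0 ≤ ε) (N : ℕ) :
    (1 / (N : ℝ) ^ k) * ∑ _n ∈ indexBox k N, ε ≤ ε := by
  rw [Finset.sum_const, card_indexBox, nsmul_eq_mul, Nat.cast_pow, ← mul_assoc, one_div_mul_eq_div]
  exact mul_le_of_le_one_left hε (div_self_le_one _)

theorem tendsto_prod_zero {ι : Type*} [Fintype ι] {F : ι → ℕ → ℝ} (h0 : ∀ i N, 0 ≤ F i N)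
    (hb : ∀ i, ∃ M, ∀ N, F i N ≤ M) {i₁ : ι} (h1 : Tendsto (F i₁) atTop (𝓝 0)) :
    Tendsto (fun N => ∏ i, F i N) atTop (𝓝 0) := by
  classical
  choose M hM using hb
  have h2 : Tendsto (fun N => F i₁ N * ∏ i ∈ Finset.univ.erase i₁, M i) atTop (𝓝 0) := by
    simpa only [zero_mul] using h1.mul_const _
  refine squeeze_zero (fun N => Finset.prod_nonneg fun i _ => h0 i N) (fun N => ?_) h2
  rw [← Finset.mul_prod_erase _ _ (Finset.mem_univ i₁)]
  exact mul_le_mul_of_nonneg_left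
    (Finset.prod_le_prod (fun i _ => h0 i N) fun i _ => hM i N) (h0 _ _)

variable {X : Type*} [MeasurableSpace X] {μ : Measure X} [IsProbabilityMeasure μ]
  {T : Lp ℂ 1 μ →L[ℂ] Lp ℂ 1 μ}

omit [IsProbabilityMeasure μ] in
theorem isDunfordSchwartz_id : IsDunfordSchwartz (ContinuousLinearMap.id ℂ (Lp ℂ 1 μ)) where
  norm_le_one := ContinuousLinearMap.norm_id_le
  eLpNorm_top_le _ := le_rfl

/-- The weighted theorem for the identity operator and the constant function `1`, read off at a
single point of the space. -/
theorem exists_tendsto_cesaro_of_mem_goodWeights (μ : Measure X) [IsProbabilityMeasure μ]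
    {a : ℕ →ᵇ ℂ} (ha : a ∈ goodWeights) :
    ∃ l : ℂ, Tendsto (fun N : ℕ => (1 / (N : ℂ)) * ∑ n ∈ Finset.Icc 1 N, a n) atTop (𝓝 l) := by
  have h1 := (isDunfordSchwartz_id (μ := μ)).weightedConverges ha (Lp.const 1 μ 1)
  obtain ⟨x, ⟨l, hl⟩, hx⟩ := (h1.and (Lp.coeFn_const 1 μ (1 : ℂ))).exists
  have h2 : ∀ n, ((ContinuousLinearMap.id ℂ (Lp ℂ 1 μ)) ^ n) (Lp.const 1 μ 1) = Lp.const 1 μ 1 :=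
    fun n => by rw [← ContinuousLinearMap.one_def, one_pow]; rfl
  refine ⟨l, hl.congr fun N => ?_⟩
  simp only [h2, hx, Function.const_apply, mul_one]

variable {p : ℝ≥0∞} [Fact (1 ≤ p)]

theorem IsDunfordSchwartz.eLpNorm_top_onLp_pow_le (hT : IsDunfordSchwartz T) (n : ℕ) (f : Lp ℂ p μ) :
    eLpNorm ((hT.onLp p ^ n) f) ∞ μ ≤ eLpNorm f ∞ μ := by
  rw [hT.coeFn_onLp_pow]
  exact (hT.pow n).eLpNorm_top_le _

/-- The `L^∞` errors survive the last power of `T`. Since multi-indices and precisions `1 / (r + 1)`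
are countable in number, a single null set serves them all. -/
theorem IsDunfordSchwartz.ae_approx (hT : IsDunfordSchwartz T) (i : Fin k)
    {B : Set (Fin k → (ℕ →ᵇ ℂ))} {h : (Fin k → ℕ) → Lp ℂ p μ} (hh : LinftyApproximable B h) :
    ∃ g : ℕ → (Fin k → ℕ) → Lp ℂ p μ, (∀ r, g r ∈ weightedSpan B (Lp ℂ p μ)) ∧
      ∀ᵐ x ∂μ, ∀ ε : ℝ, 0 < ε → ∃ r, ∀ n : Fin k → ℕ, (∀ i, 1 ≤ n i) →
        ‖(hT.onLp p ^ n i) (h n) x - (hT.onLp p ^ n i) (g r n) x‖ ≤ ε := by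
  choose g hg hgn using fun r : ℕ => hh (1 / ((r : ℝ) + 1)) (by positivity)
  refine ⟨g, hg, ?_⟩
  have h1 : ∀ᵐ x ∂μ, ∀ r, ∀ n : Fin k → ℕ, (∀ i, 1 ≤ n i) →
      ‖(hT.onLp p ^ n i) (h n) x - (hT.onLp p ^ n i) (g r n) x‖ ≤ 1 / ((r : ℝ) + 1) := by
    refine ae_all_iff.2 fun r => ae_all_iff.2 fun n => ?_
    by_cases hn : ∀ i, 1 ≤ n i
    · have h2 := (ae_norm_le_iff_eLpNorm_top_le (by positivity)).2
        ((hT.eLpNorm_top_onLp_pow_le (n i) _).trans (hgn r n hn))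
      rw [map_sub] at h2
      filter_upwards [h2, Lp.coeFn_sub ((hT.onLp p ^ n i) (h n)) ((hT.onLp p ^ n i) (g r n))]
        with x h3 h4 _
      rwa [h4] at h3
    · exact Eventually.of_forall fun x h => absurd h hn
  filter_upwards [h1] with x hx ε hε
  obtain ⟨r, hr⟩ := exists_nat_one_div_lt hε
  exact ⟨r, fun n hn => (hx r n hn).trans hr.le⟩

theorem IsDunfordSchwartz.ae_onLp_pow_smul (hT : IsDunfordSchwartz T) (i : Fin k)
    (c : (Fin k → ℕ) → ℂ) (u : (Fin k → ℕ) → Lp ℂ p μ) :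
    ∀ᵐ x ∂μ, ∀ n : Fin k → ℕ, (hT.onLp p ^ n i) (c n • u n) x = c n * (hT.onLp p ^ n i) (u n) x :=
  ae_all_iff.2 fun n => by rw [map_smul]; exact Lp.coeFn_smul _ _

theorem IsDunfordSchwartz.ae_onLp_pow_add (hT : IsDunfordSchwartz T) (i : Fin k)
    (u v : (Fin k → ℕ) → Lp ℂ p μ) :
    ∀ᵐ x ∂μ, ∀ n : Fin k → ℕ, (hT.onLp p ^ n i) (u n + v n) x
      = (hT.onLp p ^ n i) (u n) x + (hT.onLp p ^ n i) (v n) x :=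
  ae_all_iff.2 fun n => by rw [map_add]; exact Lp.coeFn_add _ _

theorem prod_mul_ite_eq {R : Type*} [CommRing R] (b : Fin k → R) (i : Fin k) (v : R) :
    ∏ j, b j * (if j = i then v else 1) = (∏ j, b j) * v := by
  rw [Finset.prod_mul_distrib, Finset.prod_ite_eq' Finset.univ i fun _ => v,
    if_pos (Finset.mem_univ i)]

/-- Averages of `weightedSpan` functions with a Cesàro null weight vanish. -/
theorem IsDunfordSchwartz.tendsto_boxAverage_norm_of_mem (hT : IsDunfordSchwartz T) (i i₁ : Fin k)
    {h : (Fin k → ℕ) → Lp ℂ p μ}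
    (hh : h ∈ weightedSpan {b | b i₁ ∈ cesaroNullIdeal} (Lp ℂ p μ)) :
    ∀ᵐ x ∂μ, Tendsto (fun N : ℕ => (1 / (N : ℝ) ^ k) *
      ∑ n ∈ indexBox k N, ‖(hT.onLp p ^ n i) (h n) x‖) atTop (𝓝 0) := by
  induction hh using Submodule.span_induction with
  | mem h hh =>
    obtain ⟨b, hb, u, rfl⟩ := hh
    set w := lpInclusion (μ := μ) (Fact.out : 1 ≤ p) u
    filter_upwards [hT.ae_onLp_pow_smul i (productWeight b) fun _ => u, hT.exists_ae_sum_le w,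
      hT.tendsto_null_weight (fun n => (b i₁).norm_coe_le_norm n) (mem_cesaroNullIdeal.1 hb) w]
      with x h1 ⟨M, hM0, hM⟩ h3
    simp only [hT.coeFn_onLp_pow] at h1
    -- The orbit value at `x` is put into the factor with index `i`; the summand becomes a product
    -- over coordinates and the box average factors.
    let F : Fin k → ℕ → ℝ := fun j n => ‖b j n‖ * if j = i then ‖(T ^ n) w x‖ else 1
    have hF : ∀ n : Fin k → ℕ, ‖(hT.onLp p ^ n i) (productWeight b n • u) x‖ = ∏ j, F j (n j) := by
      intro n
      rw [hT.coeFn_onLp_pow, h1, norm_mul, productWeight, norm_prod]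
      have h4 : ∀ j, F j (n j) = ‖b j (n j)‖ * if j = i then ‖(T ^ n i) w x‖ else 1 := by
        intro j
        by_cases hj : j = i
        · subst hj; simp [F]
        · simp [F, hj]
      simp only [h4]
      rw [prod_mul_ite_eq]
    simp only [hF, boxAverage_prod]
    -- The factor at `i₁` tends to `0`, by the null-weight ergodic theorem if `i₁ = i` and by
    -- definition of the ideal otherwise; the remaining factors only need to be bounded.
    refine tendsto_prod_zero (i₁ := i₁) (fun j N => by positivity) (fun j => ?_) ?_
    · refine ⟨‖b j‖ * (M + 1), fun N => ?_⟩
      rcases N.eq_zero_or_pos with rfl | hN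
      · simp; positivity
      have hN' : (0 : ℝ) < N := by exact_mod_cast hN
      rw [one_div, inv_mul_le_iff₀ hN']
      calc ∑ n ∈ Finset.Icc 1 N, F j n
          ≤ ∑ n ∈ Finset.Icc 1 N, ‖b j‖ * (‖(T ^ n) w x‖ + 1) := by
            refine Finset.sum_le_sum fun n _ => ?_
            refine mul_le_mul ((b j).norm_coe_le_norm n) ?_ (by positivity) (norm_nonneg _)
            split_ifs
            · linarith
            · linarith [norm_nonneg ((T ^ n) w x)]
        _ = ‖b j‖ * (∑ n ∈ Finset.Icc 1 N, ‖(T ^ n) w x‖ + N) := by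
            rw [← Finset.mul_sum, Finset.sum_add_distrib, Finset.sum_const, Nat.card_Icc,
              Nat.add_sub_cancel, nsmul_eq_mul, mul_one]
        _ ≤ ‖b j‖ * (N * M + N) := by gcongr; exact hM N
        _ = N * (‖b j‖ * (M + 1)) := by ring
    · by_cases hi : i₁ = i
      · simpa only [F, if_pos hi] using h3
      · simpa only [F, if_neg hi, mul_one] using mem_cesaroNullIdeal.1 hb
  | zero =>
    exact Eventually.of_forall fun x => by simp
  | add g g' _ _ h1 h2 =>
    filter_upwards [h1, h2, hT.ae_onLp_pow_add i g g'] with x h1 h2 h3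
    have h4 : Tendsto (fun N : ℕ => (1 / (N : ℝ) ^ k) *
        ∑ n ∈ indexBox k N, ‖(hT.onLp p ^ n i) (g n) x‖ + (1 / (N : ℝ) ^ k) *
        ∑ n ∈ indexBox k N, ‖(hT.onLp p ^ n i) (g' n) x‖) atTop (𝓝 0) := by
      simpa only [add_zero] using h1.add h2
    refine squeeze_zero (fun N => by positivity) (fun N => ?_) h4
    rw [← mul_add, ← Finset.sum_add_distrib]
    gcongr with n
    rw [Pi.add_apply, h3]
    exact norm_add_le _ _
  | smul c g _ h1 =>
    filter_upwards [h1, hT.ae_onLp_pow_smul i (fun _ => c) g] with x h1 h2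
    have h4 := h1.const_mul ‖c‖
    rw [mul_zero] at h4
    refine h4.congr fun N => ?_
    rw [mul_left_comm, Finset.mul_sum _ _ ‖c‖]
    congr 1
    refine Finset.sum_congr rfl fun n _ => ?_
    rw [Pi.smul_apply, h2, norm_mul]

/-- Averages of `weightedSpan` functions with asymptotically almost periodic weights converge. -/
theorem IsDunfordSchwartz.exists_tendsto_boxAverage_of_mem (hT : IsDunfordSchwartz T) (i : Fin k)
    {h : (Fin k → ℕ) → Lp ℂ p μ}
    (hh : h ∈ weightedSpan {b | ∀ j, b j ∈ goodWeights} (Lp ℂ p μ)) :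
    ∀ᵐ x ∂μ, ∃ l : ℂ, Tendsto (fun N : ℕ => (1 / (N : ℂ) ^ k) *
      ∑ n ∈ indexBox k N, (hT.onLp p ^ n i) (h n) x) atTop (𝓝 l) := by
  induction hh using Submodule.span_induction with
  | mem h hh =>
    obtain ⟨b, hb, u, rfl⟩ := hh
    set w := lpInclusion (μ := μ) (Fact.out : 1 ≤ p) u
    filter_upwards [hT.ae_onLp_pow_smul i (productWeight b) fun _ => u,
      hT.weightedConverges (hb i) w] with x h1 h3
    simp only [hT.coeFn_onLp_pow] at h1
    let F : Fin k → ℕ → ℂ := fun j n => b j n * if j = i then (T ^ n) w x else 1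
    have hF : ∀ n : Fin k → ℕ, (hT.onLp p ^ n i) (productWeight b n • u) x = ∏ j, F j (n j) := by
      intro n
      rw [hT.coeFn_onLp_pow, h1, productWeight]
      have h4 : ∀ j, F j (n j) = b j (n j) * if j = i then (T ^ n i) w x else 1 := by
        intro j
        by_cases hj : j = i
        · subst hj; simp [F]
        · simp [F, hj]
      simp only [h4]
      rw [prod_mul_ite_eq]
    simp only [hF, boxAverage_prod]
    -- Index `i` needs the weighted pointwise theorem; at the other indices only the mean of the
    -- weight appears.
    have hl : ∀ j, ∃ l, Tendsto (fun N : ℕ => (1 / (N : ℂ)) * ∑ n ∈ Finset.Icc 1 N, F j n) atTop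
        (𝓝 l) := by
      intro j
      by_cases hj : j = i
      · simp only [F, if_pos hj]
        exact hj ▸ h3
      · simp only [F, if_neg hj, mul_one]
        exact exists_tendsto_cesaro_of_mem_goodWeights μ (hb j)
    choose l hl using hl
    exact ⟨∏ j, l j, tendsto_finsetProd _ fun j _ => hl j⟩
  | zero =>
    exact Eventually.of_forall fun x => ⟨0, by simp⟩
  | add g g' _ _ h1 h2 =>
    filter_upwards [h1, h2, hT.ae_onLp_pow_add i g g'] with x ⟨l, hl⟩ ⟨l', hl'⟩ h3
    refine ⟨l + l', (hl.add hl').congr fun N => ?_⟩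
    rw [← mul_add, ← Finset.sum_add_distrib]
    simp only [Pi.add_apply, h3]
  | smul c g _ h1 =>
    filter_upwards [h1, hT.ae_onLp_pow_smul i (fun _ => c) g] with x ⟨l, hl⟩ h2
    refine ⟨c * l, (hl.const_mul c).congr fun N => ?_⟩
    rw [mul_left_comm, Finset.mul_sum _ _ c]
    simp only [Pi.smul_apply, h2]

theorem IsDunfordSchwartz.tendsto_boxAverage_norm (hT : IsDunfordSchwartz T) (i i₁ : Fin k)
    {h : (Fin k → ℕ) → Lp ℂ p μ} (hh : LinftyApproximable {b | b i₁ ∈ cesaroNullIdeal} h) :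
    ∀ᵐ x ∂μ, Tendsto (fun N : ℕ => (1 / (N : ℝ) ^ k) *
      ∑ n ∈ indexBox k N, ‖(hT.onLp p ^ n i) (h n) x‖) atTop (𝓝 0) := by
  obtain ⟨g, hg, hgx⟩ := hT.ae_approx i hh
  filter_upwards [hgx, ae_all_iff.2 fun r => hT.tendsto_boxAverage_norm_of_mem i i₁ (hg r)]
    with x h1 h2
  refine tendsto_zero_of_forall_approx (fun N => by positivity) fun ε hε => ?_
  obtain ⟨r, hr⟩ := h1 ε hε
  refine ⟨_, h2 r, Eventually.of_forall fun N => ?_⟩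
  refine le_trans ?_ (add_le_add_right (boxAverage_const_le (k := k) hε.le N) _)
  rw [← mul_add, ← Finset.sum_add_distrib]
  refine mul_le_mul_of_nonneg_left (Finset.sum_le_sum fun n hn => ?_) (by positivity)
  have h3 := hr n (one_le_of_mem_indexBox hn)
  linarith [norm_sub_norm_le ((hT.onLp p ^ n i) (h n) x) ((hT.onLp p ^ n i) (g r n) x)]

theorem IsDunfordSchwartz.exists_tendsto_boxAverage (hT : IsDunfordSchwartz T) (i : Fin k)
    {h : (Fin k → ℕ) → Lp ℂ p μ} (hh : LinftyApproximable {b | ∀ j, b j ∈ goodWeights} h) :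
    ∀ᵐ x ∂μ, ∃ l : ℂ, Tendsto (fun N : ℕ => (1 / (N : ℂ) ^ k) *
      ∑ n ∈ indexBox k N, (hT.onLp p ^ n i) (h n) x) atTop (𝓝 l) := by
  obtain ⟨g, hg, hgx⟩ := hT.ae_approx i hh
  filter_upwards [hgx, ae_all_iff.2 fun r => hT.exists_tendsto_boxAverage_of_mem i (hg r)]
    with x h1 h2
  refine exists_tendsto_of_forall_approx fun ε hε => ?_
  obtain ⟨r, hr⟩ := h1 ε hε
  refine ⟨_, h2 r, Eventually.of_forall fun N => ?_⟩
  refine le_trans ?_ (boxAverage_const_le (k := k) hε.le N)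
  rw [← mul_sub, ← Finset.sum_sub_distrib, norm_mul, norm_div, norm_one, norm_pow,
    Complex.norm_natCast]
  refine mul_le_mul_of_nonneg_left (norm_sum_le_of_le _ fun n hn => ?_) (by positivity)
  exact hr n (one_le_of_mem_indexBox hn)

end BoxAverages

/-! ### Weights of the entangled products, and the theorem -/

section Main

variable {X : Type*} [MeasurableSpace X] {μ : Measure X} [IsProbabilityMeasure μ] {m k : ℕ}
  {p : ℝ≥0∞} [Fact (1 ≤ p)]

theorem goodWeights_mul_mulSingle {b : Fin k → (ℕ →ᵇ ℂ)} (hb : ∀ j, b j ∈ goodWeights) (i : Fin k)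
    {c : ℕ →ᵇ ℂ} (hc : c ∈ goodWeights) (j : Fin k) :
    (b * Pi.mulSingle i c : Fin k → (ℕ →ᵇ ℂ)) j ∈ goodWeights := by
  refine goodWeights.mul_mem (hb j) ?_
  rcases eq_or_ne j i with rfl | hj
  · rwa [Pi.mulSingle_eq_same]
  · rw [Pi.mulSingle_eq_of_ne hj]
    exact goodWeights.one_mem

/-- Stability makes the first coefficients `φ(T_1^n f)` null in the index `α(1)`. The ideal property
keeps that factor null even when later operators share the same index. -/
theorem linftyApproximable_entangled_of_stable (hm : 1 < m) (α : Fin m → Fin k)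
    {T : Fin m → Lp ℂ 1 μ →L[ℂ] Lp ℂ 1 μ} (hT : ∀ j, IsDunfordSchwartz (T j))
    {A : Fin (m - 1) → Lp ℂ p μ →L[ℂ] Lp ℂ p μ}
    (hA1 : TwistedCompactness (fun j => (hT j).onLp p) A)
    (hA2 : JointLinftyBounded (fun j => (hT j).onLp p) A) {f : Lp ℂ p μ}
    (hf : f ∈ stablePart ((hT ⟨0, Nat.zero_lt_of_lt hm⟩).onLp p)) (j : ℕ) (hj : j < m - 1) :
    LinftyApproximable {b : Fin k → (ℕ →ᵇ ℂ) | b (α ⟨0, Nat.zero_lt_of_lt hm⟩) ∈ cesaroNullIdeal}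
      fun n => A ⟨j, hj⟩ (entangledStage (fun j => (hT j).onLp p) A α n f j (by omega)) := by
  set i₁ := α ⟨0, Nat.zero_lt_of_lt hm⟩
  have hB : ∀ b ∈ {b : Fin k → (ℕ →ᵇ ℂ) | b i₁ ∈ cesaroNullIdeal}, ∀ c : Fin k → (ℕ →ᵇ ℂ),
      b * c ∈ {b : Fin k → (ℕ →ᵇ ℂ) | b i₁ ∈ cesaroNullIdeal} := fun b hb c => by
    rw [Set.mem_ofPred_eq, Pi.mul_apply]
    exact Ideal.mul_mem_right (c i₁) cesaroNullIdeal hb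
  refine LinftyApproximable.entangledStage hA1 hA2 (fun j i b hb φ u =>
    ⟨orbitMap ((hT j).norm_onLp_le p) φ u, fun n => rfl, hB b hb _⟩) (fun h0 => ?_) j hj
  have h2 : ∀ φ : Lp ℂ p μ →L[ℂ] ℂ, ∃ c : ℕ →ᵇ ℂ,
      (∀ n, c n = φ (((hT ⟨0, Nat.zero_lt_of_lt hm⟩).onLp p ^ n) f)) ∧
      (1 * Pi.mulSingle i₁ c : Fin k → (ℕ →ᵇ ℂ)) ∈
        {b : Fin k → (ℕ →ᵇ ℂ) | b i₁ ∈ cesaroNullIdeal} := by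
    intro φ
    refine ⟨orbitMap ((hT ⟨0, Nat.zero_lt_of_lt hm⟩).norm_onLp_le p) φ f, fun n => rfl, ?_⟩
    rw [one_mul, Set.mem_ofPred_eq, Pi.mulSingle_eq_same]
    exact orbitMap_mem_cesaroNullIdeal _ φ hf
  have h1 := hA1.linftyApproximable (k := k) ⟨0, h0⟩ (b := 1) (i := i₁)
    (u := f) h2
  simpa only [productWeight_one, one_smul] using h1

/-- All coefficients arising are orbit sequences, hence in `goodWeights`; being an algebra, it also
contains their products when indices coincide. -/
theorem linftyApproximable_entangled (α : Fin m → Fin k)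
    {T : Fin m → Lp ℂ 1 μ →L[ℂ] Lp ℂ 1 μ} (hT : ∀ j, IsDunfordSchwartz (T j)) (hp : p ≠ ∞)
    {A : Fin (m - 1) → Lp ℂ p μ →L[ℂ] Lp ℂ p μ}
    (hA1 : TwistedCompactness (fun j => (hT j).onLp p) A)
    (hA2 : JointLinftyBounded (fun j => (hT j).onLp p) A) (f : Lp ℂ p μ) (j : ℕ) (hj : j < m - 1) :
    LinftyApproximable {b : Fin k → (ℕ →ᵇ ℂ) | ∀ i, b i ∈ goodWeights}
      fun n => A ⟨j, hj⟩ (entangledStage (fun j => (hT j).onLp p) A α n f j (by omega)) := by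
  have hB : ∀ j, ∀ i, ∀ b ∈ {b : Fin k → (ℕ →ᵇ ℂ) | ∀ i, b i ∈ goodWeights},
      ∀ φ : Lp ℂ p μ →L[ℂ] ℂ, ∀ u, ∃ c : ℕ →ᵇ ℂ, (∀ n, c n = φ (((hT j).onLp p ^ n) u)) ∧
        b * Pi.mulSingle i c ∈ {b : Fin k → (ℕ →ᵇ ℂ) | ∀ i, b i ∈ goodWeights} :=
    fun j i b hb φ u => ⟨orbitMap ((hT j).norm_onLp_le p) φ u, fun n => rfl,
      goodWeights_mul_mulSingle hb i ((hT j).orbitMap_mem_goodWeights hp φ u)⟩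
  refine LinftyApproximable.entangledStage hA1 hA2 hB (fun h0 => ?_) j hj
  have h1 := hA1.linftyApproximable (k := k) ⟨0, h0⟩ (b := 1) (i := α ⟨0, by omega⟩)
    (u := f) fun φ => hB ⟨0, by omega⟩ (α ⟨0, by omega⟩) 1 (fun _ => goodWeights.one_mem) φ f
  simpa only [productWeight_one, one_smul] using h1

end Main

end EntangledErgodic

theorem theorem1p1 {X : Type*} [MeasurableSpace X] (μ : Measure X) [IsProbabilityMeasure μ]
    (m k : ℕ) (hm : 1 < m) (hk : 0 < k) (α : Fin m → Fin k)
    (T : Fin m → Lp ℂ 1 μ →L[ℂ] Lp ℂ 1 μ) (hT : ∀ j, EntangledErgodic.IsDunfordSchwartz (T j))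
    (p : ℝ≥0∞) [Fact (1 ≤ p)] (hp : p ≠ ∞)
    (A : Fin (m - 1) → Lp ℂ p μ →L[ℂ] Lp ℂ p μ)
    (hA1 : EntangledErgodic.TwistedCompactness (fun j => (hT j).onLp p) A)
    (hA2 : EntangledErgodic.JointLinftyBounded (fun j => (hT j).onLp p) A) :
    (∀ f ∈ EntangledErgodic.stablePart ((hT ⟨0, Nat.zero_lt_of_lt hm⟩).onLp p),
      ∀ᵐ x ∂μ, Tendsto (fun N : ℕ => (1 / (N : ℝ) ^ k) *
        ∑ n ∈ EntangledErgodic.indexBox k N,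
          ‖EntangledErgodic.entangledProduct hm (fun j => (hT j).onLp p) A α n f x‖)
        atTop (𝓝 0)) ∧
    (∀ f ∈ EntangledErgodic.reversiblePart ((hT ⟨0, Nat.zero_lt_of_lt hm⟩).onLp p),
      ∀ᵐ x ∂μ, ∃ l : ℂ, Tendsto (fun N : ℕ => (1 / (N : ℂ) ^ k) *
        ∑ n ∈ EntangledErgodic.indexBox k N,
          EntangledErgodic.entangledProduct hm (fun j => (hT j).onLp p) A α n f x)
        atTop (𝓝 l)) := by
  -- In this form the last stage unfolds definitionally into a power of the last operator applied to
  -- `A ⟨j, _⟩` of stage `j`, the vector for which approximability is known.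
  obtain ⟨j, rfl⟩ : ∃ j, m = j + 2 := ⟨m - 2, by omega⟩
  refine ⟨fun f hf => ?_, fun f _ => ?_⟩
  · exact (hT ⟨j + 1, by omega⟩).tendsto_boxAverage_norm (α ⟨j + 1, by omega⟩) _
      (EntangledErgodic.linftyApproximable_entangled_of_stable hm α hT hA1 hA2 hf j (by omega))
  · exact (hT ⟨j + 1, by omega⟩).exists_tendsto_boxAverage (α ⟨j + 1, by omega⟩)
      (EntangledErgodic.linftyApproximable_entangled α hT hp hA1 hA2 f j (by omega))
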